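/- Let $n\ge 0$ and let $\Gamma$ be a group of type $\mathrm{F}_{n+1}$, i.e. $\Gamma$ has an Eilenberg--MacLane space with finite $(n+1)$-skeleton; equivalently, $\Gamma$ acts freely by simplicial automorphisms on a contractible simplicial complex $X$ with only finitely many orbits of $k$-simplices for every $k\le n+1$. Fix a finite generating set $S$ of $\Gamma$. Let $E$ be a real or complex Banach space, and let $\pi$ be a representation of $\Gamma$ on $E$ by bounded invertible operators (no uniform bound is assumed). Let $H^*(\Gamma,\pi)$ denote the group cohomology of $\Gamma$ with coefficients in the $\Gamma$-module $(E,\pi)$. For representations $\pi,\rho$ of $\Gamma$ on $E$ put $$d_S(\pi,\rho)=\sup_{s\in S}\Vert \pi_s-\rho_s\Vert_{B(E)}.$$ Assume that $H^n(\Gamma,\pi)=0$ and that there is a family $(\rho_i)_{i\in I}$ of representations of $\Gamma$ on $E$ by bounded invertible operators (deformations of $\pi$) which converges to $\pi$, i.e. $d_S(\pi,\rho_i)\to 0$ along a proper filter on $I$ (for instance, a sequence), such that $H^n(\Gamma,\rho_i)\ne 0$ for every $i$. Then $H^{n+1}(\Gamma,\pi)\neq 0$. -/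

import Mathlib

open Filter Topology

universe u

/-- The (underlying set of the) geometric realization `|K|` of an abstract simplicial complex `K`:
finitely supported barycentric coordinates which are nonnegative, sum to `1`, and whose support is
a face of `K`. -/
def GeomRealization {V : Type u} (K : AbstractSimplicialComplex V) : Type u :=
  {x : V →₀ ℝ // (∀ v, 0 ≤ x v) ∧ (x.sum fun _ t => t) = 1 ∧ x.support ∈ K.faces}

namespace GeomRealization

variable {V : Type u} {K : AbstractSimplicialComplex V}

/-- The barycentric coordinates of a point of `|K|`. -/
def coord (x : GeomRealization K) : V → ℝ := fun v => x.1 v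

/-- The closed simplex of `|K|` spanned by a finite set `s` of vertices. -/
def closedSimplex (K : AbstractSimplicialComplex V) (s : Finset V) : Type u :=
  {x : GeomRealization K // x.1.support ⊆ s}

/-- The Euclidean topology on a closed simplex: convergence of the barycentric coordinates. -/
instance (s : Finset V) : TopologicalSpace (closedSimplex K s) :=
  TopologicalSpace.induced (fun x => coord x.1) Pi.topologicalSpace

/-- The weak topology on `|K|`: a set is open if and only if its intersection with the closed
simplex of each face of `K` is open in that closed simplex. -/
instance : TopologicalSpace (GeomRealization K) :=
  ⨆ s : {s : Finset V // s ∈ K.faces},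
    TopologicalSpace.coinduced (fun x : closedSimplex K s.1 => x.1) inferInstance

end GeomRealization

/-- The translate `g • s` of a finite set of vertices. -/
def translateFace {G V : Type u} [Group G] [MulAction G V] (g : G) (s : Finset V) : Finset V :=
  s.map (MulAction.toPerm g).toEmbedding

/-- `G` is of type `F_m`: there is a contractible simplicial complex `X` (the universal cover of an
Eilenberg–MacLane space of `G`) with a free action of `G` by simplicial automorphisms, such that
for each `k ≤ m` there are only finitely many `G`-orbits of `k`-simplices (i.e. of faces with
`k + 1` vertices). As simplices may not be stabilized, even setwise, by an element `g ≠ 1`, the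
action on `|X|` is free. -/
def IsTypeF (G : Type u) [Group G] (m : ℕ) : Prop :=
  ∃ (V : Type u) (_ : MulAction G V) (X : AbstractSimplicialComplex V),
    ContractibleSpace (GeomRealization X) ∧
    (∀ (g : G), ∀ s ∈ X.faces, translateFace g s ∈ X.faces) ∧
    (∀ (g : G), ∀ s ∈ X.faces, translateFace g s = s → g = 1) ∧
    (∃ T : Set (Finset V), T.Finite ∧ T ⊆ X.faces ∧
      ∀ s ∈ X.faces, s.card ≤ m + 1 → ∃ t ∈ T, ∃ g : G, translateFace g t = s)

/-- Representations of `G` on a normed space `E` by bounded operators with bounded inverse, i.e.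
the set `Hom(G, B_inv(E))`. -/
abbrev BoundedRep (𝕜 G E : Type u) [RCLike 𝕜] [Group G] [NormedAddCommGroup E]
    [NormedSpace 𝕜 E] : Type u :=
  G →* (E →L[𝕜] E)ˣ

namespace BoundedRep

variable {𝕜 G E : Type u} [RCLike 𝕜] [Group G] [NormedAddCommGroup E] [NormedSpace 𝕜 E]

/-- The underlying algebraic representation, forgetting the norm of `E`. -/
def toRepresentation (π : BoundedRep 𝕜 G E) : Representation 𝕜 G E where
  toFun g := ((π g : E →L[𝕜] E) : E →ₗ[𝕜] E)
  map_one' := by ext; simp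
  map_mul' g h := by ext; simp

/-- The group cohomology `H^n(G, π)` of `G` with coefficients in the module `(E, π)`. -/
noncomputable def cohomology (π : BoundedRep 𝕜 G E) (n : ℕ) : ModuleCat.{u} 𝕜 :=
  groupCohomology (Rep.of π.toRepresentation) n

/-- The distance `d_S(π, ρ) = sup_{s ∈ S} ‖π_s - ρ_s‖` (operator norm), for a finite subset `S`
of `G`. The representation `ρ` is an `ε`-deformation of `π` if `d_S(π, ρ) ≤ ε`. -/
noncomputable def deformationDist (S : Finset G) (π ρ : BoundedRep 𝕜 G E) : ℝ :=
  ⨆ s : S, ‖(π s : E →L[𝕜] E) - (ρ s : E →L[𝕜] E)‖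

end BoundedRep

/-! Suppose that H^{n+1}(Γ, π) also vanishes. Let Γ act freely on a contractible complex X and
compute cohomology by equivariant cochains on ordered simplices. Such a cochain is determined by its
values on orbit representatives. In degrees at most n+1 there are finitely many of these, so the
cochain spaces are finite powers of E. These Banach spaces do not depend on the representation. Only
the coboundaries do, and each uses finitely many operators ρ_g, so d_S-convergence gives operator
norm convergence (`tendsto_coboundary`).

The vanishing of H^{n+1}(Γ, π) makes the range of C^n → C^{n+1} a kernel, hence closed
(`isClosed_range_coboundary`). The vanishing of H^n(Γ, π) says that C^{n-1} → C^n → C^{n+1} is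
exact. The open mapping theorem then gives preimages of controlled norm for both maps, and a
successive approximation shows that exactness survives small perturbations among complexes
(`eventually_exact_of_tendsto`). Hence H^n(Γ, ρ_i) = 0 eventually, a contradiction.

Most of the work identifies `groupCohomology` with this cochain model. The augmented complex of
lists of vertices lying in a common face must be a free resolution, and the point is its acyclicity
(`exists_bd_eq_of_contractible`). A cycle involves finitely many vertices, so a contraction of |X|
is needed only on a compact set, where a Lebesgue number yields simplicial approximations. An
acyclic-carrier argument with lists of nearby points replaces iterated barycentric subdivision. -/

/-! ### Chains of lists

The augmented ordered chain complex of a set `V` is modelled on finitely supported functions on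
`List V`; a list of length `n + 1` is an ordered simplex of dimension `n`. -/

namespace ListChain

variable {k : Type*} [CommRing k] {V W : Type*}

/-- The cone operator `l ↦ v :: l`. -/
noncomputable def cone (v : V) : (List V →₀ k) →ₗ[k] (List V →₀ k) :=
  Finsupp.lmapDomain k k (List.cons v)

/-- The boundary of a list, i.e. the alternating sum of its faces. -/
noncomputable def bdList (k : Type*) [CommRing k] {V : Type*} : List V → (List V →₀ k)
  | [] => 0
  | v :: l => Finsupp.single l 1 - cone v (bdList k l)

/-- The boundary operator. -/
noncomputable def bd : (List V →₀ k) →ₗ[k] (List V →₀ k) :=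
  Finsupp.linearCombination k (bdList k)

/-- The operator induced by a map of vertices. -/
noncomputable def map (f : V → W) : (List V →₀ k) →ₗ[k] (List W →₀ k) :=
  Finsupp.lmapDomain k k (List.map f)

/-- The submodule of chains supported on a set of lists. -/
noncomputable abbrev chains (k : Type*) [CommRing k] {V : Type*} (A : Set (List V)) :
    Submodule k (List V →₀ k) :=
  Finsupp.supported k k A

@[simp] lemma cone_single (v : V) (l : List V) (a : k) :
    cone v (Finsupp.single l a) = Finsupp.single (v :: l) a := by
  simp [cone]

@[simp] lemma map_single (f : V → W) (l : List V) (a : k) :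
    map f (Finsupp.single l a) = Finsupp.single (l.map f) a := by
  simp [map]

lemma bd_single (l : List V) (a : k) : bd (Finsupp.single l a) = a • bdList k l := by
  simp [bd]

@[simp] lemma bd_single_nil (a : k) : bd (Finsupp.single ([] : List V) a) = 0 := by
  simp [bd_single, bdList]

/-- Coning is a contracting homotopy; since the empty list is a simplex of degree -1, the formula
has no exceptional case in low degree. -/
lemma bd_cone (v : V) (c : List V →₀ k) : bd (cone v c) = c - cone v (bd c) := by
  induction c using Finsupp.induction_linear with
  | zero => simp
  | add f g hf hg => simp only [map_add, hf, hg]; abel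
  | single l a => simp [bd_single, bdList, smul_sub]

lemma bd_bdList (l : List V) : bd (bdList k l) = 0 := by
  induction l with
  | nil => simp [bdList]
  | cons v l ih => simp [bdList, bd_cone, ih, bd_single]

@[simp] lemma bd_bd (c : List V →₀ k) : bd (bd c) = 0 := by
  induction c using Finsupp.induction_linear with
  | zero => simp
  | add f g hf hg => simp only [map_add, hf, hg, add_zero]
  | single l a => simp [bd_single, bd_bdList]

lemma map_cone (f : V → W) (v : V) (c : List V →₀ k) :
    map f (cone v c) = cone (f v) (map f c) := by
  induction c using Finsupp.induction_linear with
  | zero => simp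
  | add f g hf hg => simp only [map_add, hf, hg]
  | single l a => simp

lemma bdList_map (f : V → W) (l : List V) : bdList k (l.map f) = map f (bdList k l) := by
  induction l with
  | nil => simp [bdList]
  | cons v l ih => simp [bdList, ih, map_cone]

lemma bd_map (f : V → W) (c : List V →₀ k) : bd (map f c) = map f (bd c) := by
  induction c using Finsupp.induction_linear with
  | zero => simp
  | add f g hf hg => simp only [map_add, hf, hg]
  | single l a => simp [bd_single, bdList_map]

lemma single_mem_chains {A : Set (List V)} {l : List V} (h : l ∈ A) (a : k) :
    Finsupp.single l a ∈ chains k A :=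
  Finsupp.single_mem_supported k a h

/-- To show that a linear map sends `chains k A` to a submodule it suffices to treat the lists
of `A`. -/
lemma map_mem_of_forall_single {A : Set (List V)} {M : Type*} [AddCommGroup M] [Module k M]
    (N : Submodule k M) (F : (List V →₀ k) →ₗ[k] M)
    (h : ∀ l ∈ A, F (Finsupp.single l 1) ∈ N) {c : List V →₀ k} (hc : c ∈ chains k A) :
    F c ∈ N := by
  rw [← Finsupp.sum_single c, Finsupp.sum, map_sum]
  refine Submodule.sum_mem _ fun l hl => ?_
  rw [← Finsupp.smul_single_one, map_smul]
  exact N.smul_mem _ (h l (hc hl))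

lemma eq_of_forall_single {A : Set (List V)} {M : Type*} [AddCommGroup M] [Module k M]
    (F G : (List V →₀ k) →ₗ[k] M)
    (h : ∀ l ∈ A, F (Finsupp.single l 1) = G (Finsupp.single l 1)) {c : List V →₀ k}
    (hc : c ∈ chains k A) : F c = G c := by
  have := map_mem_of_forall_single (⊥ : Submodule k M) (F - G)
    (fun l hl => by simp [h l hl]) hc
  simpa [sub_eq_zero] using this

lemma cone_mem_chains {A B : Set (List V)} {v : V} (h : ∀ l ∈ A, v :: l ∈ B)
    {c : List V →₀ k} (hc : c ∈ chains k A) : cone v c ∈ chains k B :=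
  map_mem_of_forall_single _ _ (fun l hl => by simpa using single_mem_chains (h l hl) 1) hc

lemma map_mem_chains {A : Set (List V)} {B : Set (List W)} {f : V → W}
    (h : ∀ l ∈ A, l.map f ∈ B) {c : List V →₀ k} (hc : c ∈ chains k A) :
    map f c ∈ chains k B :=
  map_mem_of_forall_single _ _ (fun l hl => by simpa using single_mem_chains (h l hl) 1) hc

lemma bdList_mem_chains (l : List V) :
    bdList k l ∈ chains k {m | m.Sublist l ∧ m.length + 1 = l.length} := by
  induction l with
  | nil => simp [bdList]
  | cons v l ih =>
    refine Submodule.sub_mem _ (single_mem_chains ?_ _) (cone_mem_chains ?_ ih)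
    · exact ⟨List.sublist_cons_self v l, rfl⟩
    · exact fun m hm => ⟨hm.1.cons_cons v, by simpa using hm.2⟩

lemma bd_mem_chains {A B : Set (List V)}
    (h : ∀ l ∈ A, ∀ m, m.Sublist l → m.length + 1 = l.length → m ∈ B)
    {c : List V →₀ k} (hc : c ∈ chains k A) : bd c ∈ chains k B :=
  map_mem_of_forall_single _ _ (fun l hl => by
    rw [bd_single, one_smul]
    exact Finsupp.supported_mono (fun m hm => h l hl m hm.1 hm.2) (bdList_mem_chains l)) hc

/-- If a vertex can be added to all lists of `A`, then the chains on `A` are acyclic. -/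
lemma exists_bd_eq_of_cone {A : Set (List V)} {v : V} (h : ∀ l ∈ A, v :: l ∈ A)
    {c : List V →₀ k} (hc : c ∈ chains k A) (hd : bd c = 0) :
    ∃ b ∈ chains k A, bd b = c :=
  ⟨cone v c, cone_mem_chains h hc, by simp [bd_cone, hd]⟩

/-- The prism operator on a list. -/
noncomputable def prismList (k : Type*) [CommRing k] (f g : V → W) : List V → (List W →₀ k)
  | [] => 0
  | v :: l => cone (f v) (Finsupp.single (g v :: l.map g) 1 - prismList k f g l)

/-- The prism operator, a chain homotopy from `map f` to `map g`. -/
noncomputable def prism (f g : V → W) : (List V →₀ k) →ₗ[k] (List W →₀ k) :=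
  Finsupp.linearCombination k (prismList k f g)

lemma prism_single (f g : V → W) (l : List V) (a : k) :
    prism f g (Finsupp.single l a) = a • prismList k f g l := by
  simp [prism]

lemma prism_cone (f g : V → W) (v : V) (c : List V →₀ k) :
    prism f g (cone v c) = cone (f v) (cone (g v) (map g c) - prism f g c) := by
  induction c using Finsupp.induction_linear with
  | zero => simp
  | add f g hf hg => simp only [map_add, map_sub, hf, hg]; abel
  | single l a => simp [prism_single, prismList, smul_sub]

/-- The prism is built by coning over the prism of the tail, so `bd_cone` reduces the homotopy
formula to the tail. -/
lemma bd_prismList (f g : V → W) (l : List V) :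
    bd (prismList k f g l) + prism f g (bdList k l) =
      Finsupp.single (l.map g) 1 - Finsupp.single (l.map f) 1 := by
  induction l with
  | nil => simp [prismList, bdList]
  | cons v l ih =>
    have e : bd (Finsupp.single (g v :: l.map g) (1 : k)) =
        Finsupp.single (l.map g) 1 - cone (g v) (map g (bdList k l)) := by
      rw [bd_single, one_smul, bdList, bdList_map]
    have ih' := congrArg (cone (f v)) (eq_sub_of_add_eq ih)
    simp only [map_sub, cone_single] at ih'
    rw [prismList, bd_cone, map_sub, e]
    simp only [bdList, map_sub, prism_single, prism_cone, ih', cone_single, List.map_cons,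
      one_smul]
    abel

lemma bd_prism (f g : V → W) (c : List V →₀ k) :
    bd (prism f g c) + prism f g (bd c) = map g c - map f c := by
  induction c using Finsupp.induction_linear with
  | zero => simp
  | add c c' h h' =>
    simp only [map_add]
    rw [add_sub_add_comm, ← h, ← h']
    abel
  | single l a =>
    have := congrArg (a • ·) (bd_prismList (k := k) f g l)
    simpa [prism_single, bd_single, smul_sub, smul_add] using this

lemma prismList_mem_chains (f g : V → W) (l : List V) :
    prismList k f g l ∈ chains k {m | ∀ y ∈ m, ∃ x ∈ l, y = f x ∨ y = g x} := by
  induction l with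
  | nil => simp [prismList]
  | cons v l ih =>
    refine cone_mem_chains (A := {m | ∀ y ∈ m, ∃ x ∈ v :: l, y = f x ∨ y = g x}) ?_
      (Submodule.sub_mem _ (single_mem_chains ?_ _) (Finsupp.supported_mono ?_ ih))
    · intro m hm y hy
      rcases List.mem_cons.1 hy with rfl | hy
      · exact ⟨v, by simp, Or.inl rfl⟩
      · exact hm y hy
    · intro y hy
      rw [← List.map_cons, List.mem_map] at hy
      obtain ⟨x, hx, rfl⟩ := hy
      exact ⟨x, hx, Or.inr rfl⟩
    · intro m hm y hy
      obtain ⟨x, hx, h⟩ := hm y hy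
      exact ⟨x, List.mem_cons_of_mem _ hx, h⟩

lemma prism_mem_chains {A : Set (List V)} {B : Set (List W)} {f g : V → W}
    (h : ∀ l ∈ A, ∀ m : List W, (∀ y ∈ m, ∃ x ∈ l, y = f x ∨ y = g x) → m ∈ B)
    {c : List V →₀ k} (hc : c ∈ chains k A) : prism f g c ∈ chains k B :=
  map_mem_of_forall_single _ _ (fun l hl => by
    rw [prism_single, one_smul]
    exact Finsupp.supported_mono (fun m hm => h l hl m hm) (prismList_mem_chains f g l)) hc

/-- Contiguous maps send a cycle to homologous cycles. -/
lemma exists_bd_eq_map_sub_map {A : Set (List V)} {B : Set (List W)} {f g : V → W}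
    (h : ∀ l ∈ A, ∀ m : List W, (∀ y ∈ m, ∃ x ∈ l, y = f x ∨ y = g x) → m ∈ B)
    {c : List V →₀ k} (hc : c ∈ chains k A) (hd : bd c = 0) :
    ∃ b ∈ chains k B, bd b = map g c - map f c :=
  ⟨prism f g c, prism_mem_chains h hc, by simp [← bd_prism, hd]⟩

/-- A chain of contiguous maps sends a cycle to homologous cycles. -/
lemma exists_bd_eq_map_sub_map_of_chain {A : Set (List V)} {B : Set (List W)} {f : ℕ → V → W}
    {n : ℕ} (h : ∀ j < n, ∀ l ∈ A, ∀ m : List W,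
      (∀ y ∈ m, ∃ x ∈ l, y = f j x ∨ y = f (j + 1) x) → m ∈ B)
    {c : List V →₀ k} (hc : c ∈ chains k A) (hd : bd c = 0) :
    ∃ b ∈ chains k B, bd b = map (f n) c - map (f 0) c := by
  induction n with
  | zero => exact ⟨0, Submodule.zero_mem _, by simp⟩
  | succ n ih =>
    obtain ⟨b, hb, e⟩ := ih fun j hj => h j (by omega)
    obtain ⟨b', hb', e'⟩ := exists_bd_eq_map_sub_map (h n (by omega)) hc hd
    exact ⟨b' + b, Submodule.add_mem _ hb' hb, by rw [map_add, e, e']; abel⟩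

/-! ### Acyclic carriers -/

section Lift

variable (A : Set (List V)) (B : List V → Submodule k (List W →₀ k))
  (r : (List V →₀ k) →ₗ[k] (List W →₀ k)) (ε : k) (e : List W →₀ k)

open Classical in
/-- One step in the construction of a lift: solve the equation `bd b = r l + ε • f (bd l)`
in `B l`. -/
noncomputable def liftStep (f : List V → (List W →₀ k)) (l : List V) : List W →₀ k :=
  if l = [] then e else
    if h : ∃ b ∈ B l, bd b = r (Finsupp.single l 1) +
      ε • Finsupp.linearCombination k f (bdList k l) then h.choose else 0

/-- The successive approximations of a lift. -/
noncomputable def liftIter : ℕ → List V → (List W →₀ k)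
  | 0 => liftStep B r ε e 0
  | n + 1 => liftStep B r ε e (liftIter n)

lemma linearCombination_bdList_congr {M : Type*} [AddCommGroup M] [Module k M]
    {f g : List V → M} {l : List V}
    (h : ∀ m : List V, m.Sublist l → m.length + 1 = l.length → f m = g m) :
    Finsupp.linearCombination k f (bdList k l) = Finsupp.linearCombination k g (bdList k l) :=
  eq_of_forall_single _ _ (fun m hm => by simp [h m hm.1 hm.2]) (bdList_mem_chains l)

/-- The step at a list only consults lists shorter by one, so iterating as often as the length of
the list reaches a solution of the recursion. -/
lemma liftStep_congr {f g : List V → (List W →₀ k)} {l : List V}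
    (h : ∀ m : List V, m.length + 1 = l.length → f m = g m) :
    liftStep B r ε e f l = liftStep B r ε e g l := by
  have := linearCombination_bdList_congr (k := k) fun m (_ : m.Sublist l) hm => h m hm
  unfold liftStep
  rw [this]

/-- The method of acyclic carriers: if the carriers `B l` are acyclic, one can solve the equation
`bd (F l) = r l + ε F (bd l)` with `F l ∈ B l`. -/
theorem exists_lift (hA : ∀ l ∈ A, ∀ m : List V, m.Sublist l → m ∈ A)
    (hB : ∀ l ∈ A, ∀ m : List V, m.Sublist l → B m ≤ B l)
    (hex : ∀ l ∈ A, l ≠ [] → ∀ c ∈ B l, bd c = 0 → ∃ b ∈ B l, bd b = c)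
    (hr : ∀ l ∈ A, l ≠ [] → r (Finsupp.single l 1) ∈ B l)
    (hrd : ∀ l ∈ A, bd (r (Finsupp.single l 1)) + ε • r (bdList k l) = 0)
    (he : e ∈ B []) (hed : bd e = r (Finsupp.single [] 1)) :
    ∃ F : (List V →₀ k) →ₗ[k] (List W →₀ k), F (Finsupp.single [] 1) = e ∧
      (∀ l ∈ A, F (Finsupp.single l 1) ∈ B l) ∧
      ∀ c ∈ chains k A, bd (F c) = r c + ε • F (bd c) := by
  set f : List V → (List W →₀ k) := fun l => liftIter B r ε e l.length l with hf
  have hfix : ∀ l, f l = liftStep B r ε e f l := by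
    intro l
    rcases hl : l.length with _ | j
    · rw [List.length_eq_zero_iff] at hl
      subst hl
      simp [hf, liftIter, liftStep]
    · simp only [hf, hl, liftIter]
      exact liftStep_congr B r ε e fun m hm => by rw [show j = m.length by omega]
  have hnil : f [] = e := by rw [hfix]; simp [liftStep]
  have key : ∀ n : ℕ, ∀ l ∈ A, l.length ≤ n → f l ∈ B l ∧
      bd (f l) = r (Finsupp.single l 1) + ε • Finsupp.linearCombination k f (bdList k l) := by
    intro n
    induction n with
    | zero =>
      intro l hl h
      rw [Nat.le_zero, List.length_eq_zero_iff] at h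
      subst h
      rw [hnil]
      exact ⟨he, by simp [hed, bdList]⟩
    | succ n ih =>
      intro l hl h
      by_cases hl0 : l = []
      · subst hl0
        exact ih [] hl (by simp)
      have hbm : ∀ m ∈ {m : List V | m.Sublist l ∧ m.length + 1 = l.length}, f m ∈ B m ∧
          bd (f m) = r (Finsupp.single m 1) +
            ε • Finsupp.linearCombination k f (bdList k m) :=
        fun m hm => ih m (hA l hl m hm.1) (by have := hm.2; omega)
      have h1 : Finsupp.linearCombination k f (bdList k l) ∈ B l :=
        map_mem_of_forall_single _ _ (fun m hm => by
          simpa using hB l hl m hm.1 (hbm m hm).1) (bdList_mem_chains l)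
      have h2 : bd (Finsupp.linearCombination k f (bdList k l)) = r (bdList k l) := by
        have := eq_of_forall_single (bd ∘ₗ Finsupp.linearCombination k f)
          (r + ε • (Finsupp.linearCombination k f ∘ₗ bd)) (fun m hm => by
            simpa [bd_single] using (hbm m hm).2) (bdList_mem_chains (k := k) l)
        simpa [bd_bdList] using this
      -- The right-hand side is a cycle: by `h2` the second term has boundary `ε • r (bdList k l)`,
      -- which `hrd` cancels against the boundary of the first.
      have hsol : ∃ b ∈ B l, bd b = r (Finsupp.single l 1) +
          ε • Finsupp.linearCombination k f (bdList k l) :=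
        hex l hl hl0 _ (Submodule.add_mem _ (hr l hl hl0) (Submodule.smul_mem _ _ h1)) (by
          rw [map_add, map_smul, h2, hrd l hl])
      have : f l = hsol.choose := by rw [hfix, liftStep, if_neg hl0, dif_pos hsol]
      rw [this]
      exact hsol.choose_spec
  refine ⟨Finsupp.linearCombination k f, by simp [hnil], fun l hl => ?_, fun c hc => ?_⟩
  · simpa using (key _ l hl le_rfl).1
  · exact eq_of_forall_single (bd ∘ₗ Finsupp.linearCombination k f)
      (r + ε • (Finsupp.linearCombination k f ∘ₗ bd)) (fun l hl => by
        simpa [bd_single] using (key _ l hl le_rfl).2) hc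

end Lift

end ListChain

/-! ### Acyclicity of small lists of points in a convex set -/

namespace ListChain

variable {k : Type*} [CommRing k]

/-- The lists of points of `N` of diameter less than `δ`. -/
def smallLists {X : Type*} [PseudoMetricSpace X] (N : Set X) (δ : ℝ) : Set (List X) :=
  {l | (∀ x ∈ l, x ∈ N) ∧ ∀ x ∈ l, ∀ y ∈ l, dist x y < δ}

lemma map_eq_self {V : Type*} {f : V → V} (h : ∀ v, f v = v) (c : List V →₀ k) :
    map f c = c := by
  obtain rfl : f = id := funext h
  have : List.map (id : V → V) = id := funext fun l => List.map_id l
  simp [map, this]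

/-- At a common time, moving towards `a` does not increase distances; changing the time by at most
`ε` costs at most `ε * D`. -/
lemma dist_lineMap_lineMap_lt {X : Type*} [NormedAddCommGroup X] [NormedSpace ℝ X] {x y a : X}
    {s t ε δ' δ D : ℝ} (hs : s ∈ Set.Icc (0 : ℝ) 1) (hst : |s - t| ≤ ε) (hxy : dist x y ≤ δ')
    (hya : dist y a ≤ D) (h : ε * D < δ - δ') :
    dist (AffineMap.lineMap x a s) (AffineMap.lineMap y a t) < δ := by
  have h1 : dist (AffineMap.lineMap x a s) (AffineMap.lineMap y a s) ≤ δ' := by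
    rw [dist_eq_norm, AffineMap.lineMap_apply_module, AffineMap.lineMap_apply_module,
      add_sub_add_right_eq_sub, ← smul_sub, norm_smul, Real.norm_eq_abs,
      abs_of_nonneg (by linarith [hs.2])]
    rw [dist_eq_norm] at hxy
    nlinarith [hs.1, norm_nonneg (x - y)]
  have h2 : dist (AffineMap.lineMap y a s) (AffineMap.lineMap y a t) ≤ ε * D := by
    rw [dist_lineMap_lineMap, Real.dist_eq]
    exact mul_le_mul hst hya dist_nonneg ((abs_nonneg _).trans hst)
  linarith [dist_triangle (AffineMap.lineMap x a s) (AffineMap.lineMap y a s)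
    (AffineMap.lineMap y a t)]

/-- Small lists of points in a bounded convex set form an acyclic complex. -/
theorem exists_bd_eq_of_convex {X : Type*} [NormedAddCommGroup X] [NormedSpace ℝ X] {N : Set X}
    (hN : Convex ℝ N) (hb : Bornology.IsBounded N) (hne : N.Nonempty) {δ : ℝ} (hδ : 0 < δ)
    {c : List X →₀ k} (hc : c ∈ chains k (smallLists N δ)) (hd : bd c = 0) :
    ∃ b ∈ chains k (smallLists N δ), bd b = c := by
  classical
  obtain ⟨a, ha⟩ := hne
  obtain ⟨D, hD⟩ := Metric.isBounded_iff.1 hb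
  obtain ⟨δ', hδ', hlt⟩ : ∃ δ', (∀ l ∈ c.support, ∀ x ∈ l.toFinset, ∀ y ∈ l.toFinset,
      dist x y < δ') ∧ δ' < δ := by
    -- The support is finite, so its strict bounds leave a margin `δ - δ'`. This pays for
    -- contracting to `a` in `n` discrete steps.
    have h1 : ∀ᶠ δ' in 𝓝[<] δ, ∀ l ∈ c.support, ∀ x ∈ l.toFinset, ∀ y ∈ l.toFinset,
        dist x y < δ' := by
      simp only [Finset.eventually_all]
      intro l hl x hx y hy
      exact Filter.Eventually.filter_mono nhdsWithin_le_nhds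
        (lt_mem_nhds ((hc hl).2 x (List.mem_toFinset.1 hx) y (List.mem_toFinset.1 hy)))
    exact (h1.and self_mem_nhdsWithin).exists
  obtain ⟨n, hn0, hn⟩ : ∃ n : ℕ, 0 < n ∧ 1 / (n : ℝ) * D < δ - δ' := by
    have h1 : Tendsto (fun n : ℕ => 1 / (n : ℝ) * D) atTop (𝓝 (0 * D)) :=
      tendsto_one_div_atTop_nhds_zero_nat.mul_const D
    rw [zero_mul] at h1
    exact ((eventually_gt_atTop 0).and (h1.eventually_lt_const (by linarith))).exists
  have hn0' : (0 : ℝ) < n := Nat.cast_pos.2 hn0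
  set f : ℕ → X → X := fun j x => AffineMap.lineMap x a ((j : ℝ) / n) with hf
  have hc' : c ∈ chains k {l | (∀ x ∈ l, x ∈ N) ∧ ∀ x ∈ l, ∀ y ∈ l, dist x y ≤ δ'} :=
    fun l hl => ⟨(hc hl).1, fun x hx y hy =>
      (hδ' l hl x (List.mem_toFinset.2 hx) y (List.mem_toFinset.2 hy)).le⟩
  have hcontig : ∀ j < n, ∀ l ∈ {l : List X | (∀ x ∈ l, x ∈ N) ∧ ∀ x ∈ l, ∀ y ∈ l, dist x y ≤ δ'},
      ∀ m : List X, (∀ y ∈ m, ∃ x ∈ l, y = f j x ∨ y = f (j + 1) x) → m ∈ smallLists N δ := by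
    intro j hj l hl m hm
    have hj1 : ((j + 1 : ℕ) : ℝ) ≤ n := Nat.cast_le.2 hj
    have hm' : ∀ y ∈ m, ∃ x ∈ l, ∃ i : ℕ, (i = j ∨ i = j + 1) ∧ y = f i x := by
      intro y hy
      obtain ⟨x, hx, h | h⟩ := hm y hy
      exacts [⟨x, hx, j, Or.inl rfl, h⟩, ⟨x, hx, j + 1, Or.inr rfl, h⟩]
    have hI : ∀ i : ℕ, (i = j ∨ i = j + 1) → (i : ℝ) / n ∈ Set.Icc (0 : ℝ) 1 := by
      intro i hi
      have : i ≤ n := by omega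
      exact ⟨by positivity, div_le_one_of_le₀ (Nat.cast_le.2 this) hn0'.le⟩
    refine ⟨fun y hy => ?_, fun y hy z hz => ?_⟩
    · obtain ⟨x, hx, i, hi, rfl⟩ := hm' y hy
      exact hN.lineMap_mem (hl.1 x hx) ha (hI i hi)
    · obtain ⟨x, hx, i, hi, rfl⟩ := hm' y hy
      obtain ⟨x', hx', i', hi', rfl⟩ := hm' z hz
      refine dist_lineMap_lineMap_lt (hI i hi) ?_ (hl.2 x hx x' hx') (hD (hl.1 x' hx') ha) hn
      rw [← sub_div, abs_div, abs_of_pos hn0']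
      gcongr
      rcases hi with rfl | rfl <;> rcases hi' with rfl | rfl <;> simp
  obtain ⟨b, hb, hbd⟩ := exists_bd_eq_map_sub_map_of_chain hcontig hc' hd
  rw [map_eq_self (f := f 0) (by simp [hf])] at hbd
  have hconst : map (f n) c ∈ chains k {l : List X | ∀ x ∈ l, x = a} := by
    refine map_mem_chains (A := Set.univ) (fun l _ x hx => ?_) (fun _ _ => trivial)
    obtain ⟨y, -, rfl⟩ := List.mem_map.1 hx
    simp [hf, hn0'.ne']
  obtain ⟨b', hb', hbd'⟩ := exists_bd_eq_of_cone (v := a) (fun l hl => by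
    intro x hx
    rcases List.mem_cons.1 hx with rfl | hx
    exacts [rfl, hl x hx]) hconst (by rw [bd_map, hd, map_zero])
  refine ⟨b' - b, Submodule.sub_mem _ (Finsupp.supported_mono (fun l hl => ?_) hb') hb, ?_⟩
  · exact ⟨fun x hx => hl x hx ▸ ha, fun x hx y hy => by rw [hl x hx, hl y hy, dist_self]; exact hδ⟩
  · rw [map_sub, hbd, hbd']; abel

end ListChain

/-! ### Compact pieces of the realization and approximation by vertices -/

namespace GeomRealization

variable {V : Type u} {K : AbstractSimplicialComplex V}

/-- The points of the standard simplex on the finite set `F` which vanish outside `s`. -/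
def subSimplex (F : Finset V) (s : Set V) : Set (F → ℝ) :=
  {x | x ∈ stdSimplex ℝ F ∧ ∀ v : F, v.1 ∉ s → x v = 0}

lemma isClosed_subSimplex (F : Finset V) (s : Set V) : IsClosed (subSimplex F s) := by
  have : subSimplex F s = stdSimplex ℝ F ∩ ⋂ v : F, ⋂ _ : v.1 ∉ s, {x | x v = 0} := by
    ext x; simp [subSimplex]
  rw [this]
  exact (isClosed_stdSimplex ℝ F).inter (isClosed_iInter fun v => isClosed_iInter fun _ =>
    isClosed_eq (continuous_apply v) continuous_const)

lemma convex_subSimplex (F : Finset V) (s : Set V) : Convex ℝ (subSimplex F s) := by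
  intro x hx y hy a b ha hb hab
  exact ⟨convex_stdSimplex ℝ F hx.1 hy.1 ha hb hab, fun v hv => by simp [hx.2 v hv, hy.2 v hv]⟩

lemma isBounded_subSimplex (F : Finset V) (s : Set V) : Bornology.IsBounded (subSimplex F s) :=
  (bounded_stdSimplex F).subset fun _ hx => hx.1

/-- The realization of the full subcomplex on the finite set `F` of vertices. -/
def finitePart (K : AbstractSimplicialComplex V) (F : Finset V) : Set (F → ℝ) :=
  {x | ∃ s ∈ K.faces, x ∈ subSimplex F s}

/-- The subsets of `F` which are contained in a face. -/
def finiteFaces (K : AbstractSimplicialComplex V) (F : Finset V) : Set (Finset V) :=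
  {t | t ⊆ F ∧ ∃ s ∈ K.faces, t ⊆ s}

instance (F : Finset V) : Finite (finiteFaces K F) :=
  (F.powerset.finite_toSet.subset fun _ ht => Finset.mem_powerset.2 ht.1).to_subtype

/-- Only the trace of a face on `F` matters, so a possibly infinite union becomes a finite union of
closed sets. -/
lemma finitePart_eq (F : Finset V) :
    finitePart K F = ⋃ t : finiteFaces K F, subSimplex F (t.1 : Set V) := by
  classical
  ext x
  simp only [Set.mem_iUnion]
  constructor
  · rintro ⟨s, hs, hx⟩
    refine ⟨⟨s ∩ F, Finset.inter_subset_right, s, hs, Finset.inter_subset_left⟩, hx.1, ?_⟩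
    intro v hv
    exact hx.2 v (by simpa using hv)
  · rintro ⟨⟨t, _, s, hs, hts⟩, hx⟩
    exact ⟨s, hs, hx.1, fun v hv => hx.2 v fun h => hv (hts h)⟩

lemma isCompact_finitePart (F : Finset V) : IsCompact (finitePart K F) := by
  refine IsCompact.of_isClosed_subset (isCompact_stdSimplex ℝ F) ?_ ?_
  · rw [finitePart_eq]
    exact isClosed_iUnion_of_finite fun t => isClosed_subSimplex F _
  · rintro x ⟨s, -, hx⟩
    exact hx.1

open Classical in
/-- Extension of barycentric coordinates by zero. -/
noncomputable def extendCoord {F : Finset V} (x : F → ℝ) (v : V) : ℝ :=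
  if h : v ∈ F then x ⟨v, h⟩ else 0

/-- Extension by zero embeds `finitePart K F` into the realization of `K`. -/
noncomputable def ofFinitePart {F : Finset V} (x : finitePart K F) : GeomRealization K :=
  ⟨Finsupp.onFinset F (extendCoord x.1) (fun v hv => by
      by_contra h; exact hv (by simp [extendCoord, h])), by
    obtain ⟨x, s, hs, hx⟩ := x
    refine ⟨fun v => ?_, ?_, ?_⟩
    · simp only [Finsupp.onFinset_apply, extendCoord]
      split_ifs with h
      exacts [hx.1.1 _, le_rfl]
    · rw [Finsupp.onFinset_sum _ (fun _ => rfl), ← hx.1.2, ← Finset.sum_coe_sort]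
      exact Finset.sum_congr rfl fun v _ => by simp [extendCoord]
    · refine (K.isRelLowerSet_faces hs).2 (b := _) (fun v hv => ?_) ?_
      · by_contra h
        rw [Finsupp.mem_support_iff, Finsupp.onFinset_apply] at hv
        refine hv ?_
        simp only [extendCoord]
        split_ifs with h'
        exacts [hx.2 ⟨v, h'⟩ h, rfl]
      · by_contra h
        rw [Finset.not_nonempty_iff_eq_empty, Finsupp.support_eq_empty] at h
        have h0 : ∀ v : F, x v = 0 := fun v => by
          have := DFunLike.congr_fun h v.1
          simpa [extendCoord] using this
        have := hx.1.2
        simp [h0] at this⟩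

lemma coord_ofFinitePart {F : Finset V} (x : finitePart K F) (v : V) :
    coord (ofFinitePart x) v = extendCoord x.1 v := rfl

lemma continuous_closedSimplex_val {s : Finset V} (hs : s ∈ K.faces) :
    Continuous (fun x : closedSimplex K s => x.1) := by
  rw [continuous_iff_coinduced_le]
  exact le_iSup (fun s : {s : Finset V // s ∈ K.faces} =>
    TopologicalSpace.coinduced (fun x : closedSimplex K s.1 => x.1) inferInstance) ⟨s, hs⟩

/-- Continuity can be checked on a finite closed cover, and on each piece the map factors through
one closed simplex, where the weak topology causes no difficulty. -/
lemma continuous_ofFinitePart (F : Finset V) :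
    Continuous (ofFinitePart : finitePart K F → GeomRealization K) := by
  refine (locallyFinite_of_finite fun t : finiteFaces K F =>
    {x : finitePart K F | x.1 ∈ subSimplex F (t.1 : Set V)}).continuous ?_ (fun t => ?_)
    (fun t => ?_)
  · refine Set.eq_univ_of_forall fun x => ?_
    obtain ⟨t, ht⟩ := Set.mem_iUnion.1 ((Set.ext_iff.1 (finitePart_eq F) x.1).1 x.2)
    exact Set.mem_iUnion.2 ⟨t, ht⟩
  · exact (isClosed_subSimplex F _).preimage continuous_subtype_val
  · obtain ⟨t, -, s, hs, hts⟩ := t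
    rw [continuousOn_iff_continuous_domRestrict]
    let g : {x : finitePart K F | x.1 ∈ subSimplex F (t : Set V)} → closedSimplex K s :=
      fun x => ⟨ofFinitePart x.1, fun v hv => by
        by_contra h
        rw [Finsupp.mem_support_iff] at hv
        refine hv ?_
        change extendCoord x.1.1 v = 0
        simp only [extendCoord]
        split_ifs with h'
        exacts [x.2.2 ⟨v, h'⟩ fun h'' => h (hts h''), rfl]⟩
    have hg : Continuous g := by
      refine continuous_induced_rng.2 (continuous_pi fun v => ?_)
      change Continuous fun x : {x : finitePart K F | x.1 ∈ subSimplex F (t : Set V)} =>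
        extendCoord x.1.1 v
      simp only [extendCoord]
      split_ifs with h
      · exact (continuous_apply (⟨v, h⟩ : F)).comp
          (continuous_subtype_val.comp continuous_subtype_val)
      · exact continuous_const
    exact (continuous_closedSimplex_val hs).comp hg

/-- The open star of a vertex is open. -/
lemma isOpen_star (v : V) : IsOpen {x : GeomRealization K | 0 < coord x v} := by
  rw [isOpen_iSup_iff]
  intro s
  rw [isOpen_coinduced]
  have : Continuous fun x : closedSimplex K s.1 => coord x.1 v :=
    (continuous_apply v).comp continuous_induced_dom
  exact isOpen_lt continuous_const this

lemma exists_coord_pos (x : GeomRealization K) : ∃ v, 0 < coord x v := by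
  obtain ⟨v, hv⟩ := (K.isRelLowerSet_faces x.2.2.2).1
  exact ⟨v, lt_of_le_of_ne (x.2.1 v) (Finsupp.mem_support_iff.1 hv).symm⟩

lemma mem_support_of_coord_pos {x : GeomRealization K} {v : V} (h : 0 < coord x v) :
    v ∈ x.1.support :=
  Finsupp.mem_support_iff.2 h.ne'

/-- A simplicial approximation of a contraction of the realization, restricted to
`finitePart K F`. -/
lemma exists_vertex_map [ContractibleSpace (GeomRealization K)] (F : Finset V) :
    ∃ (G : finitePart K F × unitInterval → GeomRealization K) (y : GeomRealization K)
      (φ : finitePart K F × unitInterval → V) (δ : ℝ), 0 < δ ∧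
      (∀ x, G (x, 0) = ofFinitePart x) ∧ (∀ x, G (x, 1) = y) ∧
      ∀ p q, dist q p < δ → 0 < coord (G q) (φ p) := by
  obtain ⟨y, ⟨H⟩⟩ := id_nullhomotopic (GeomRealization K)
  have : CompactSpace (finitePart K F) := isCompact_iff_compactSpace.1 (isCompact_finitePart F)
  let G : finitePart K F × unitInterval → GeomRealization K := fun p => H (p.2, ofFinitePart p.1)
  have hG : Continuous G := H.continuous.comp
    (continuous_snd.prodMk ((continuous_ofFinitePart F).comp continuous_fst))
  -- The open stars of the vertices cover the realization; `δ` is a Lebesgue number for their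
  -- preimages under the contraction `G`.
  obtain ⟨δ, hδ, h⟩ := lebesgue_number_lemma_of_metric
    (isCompact_univ (X := finitePart K F × unitInterval))
    (c := fun v : V => {p | 0 < coord (G p) v})
    (fun v => (isOpen_star v).preimage hG)
    (fun p _ => Set.mem_iUnion.2 (exists_coord_pos (G p)))
  choose φ hφ using fun p => h p (Set.mem_univ p)
  exact ⟨G, y, φ, δ, hδ, fun x => by simp [G], fun x => by simp [G], fun p q hq => hφ p hq⟩

end GeomRealization

/-! ### Contractible realization implies acyclic chains -/

namespace ListChain

open GeomRealization

variable {k : Type*} [CommRing k] {V : Type u} {K : AbstractSimplicialComplex V}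

/-- The lists whose entries lie in a common face. -/
def faceLists (K : AbstractSimplicialComplex V) : Set (List V) :=
  {l | ∃ s ∈ K.faces, ∀ v ∈ l, v ∈ s}

/-- `ψ j` approximates the contraction at the j-th time of a fine subdivision. For a small list with
first point `x₀`, the vertices chosen at all its points and at two consecutive times have open stars
containing the single point `G (x₀, t j)`. They therefore lie in its support, which is a face. -/
lemma exists_contiguous_maps [ContractibleSpace (GeomRealization K)] (F : Finset V) :
    ∃ (δ : ℝ) (n : ℕ) (ψ : ℕ → (F → ℝ) → V), 0 < δ ∧
      (∀ s : Set V, ∀ x ∈ finitePart K F, x ∈ subSimplex F s → ψ 0 x ∈ s) ∧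
      (∀ j < n, ∀ l ∈ smallLists (finitePart K F) δ,
        ∃ s ∈ K.faces, ∀ x ∈ l, ψ j x ∈ s ∧ ψ (j + 1) x ∈ s) ∧
      (∃ s ∈ K.faces, ∀ x ∈ finitePart K F, ψ n x ∈ s) := by
  classical
  obtain ⟨G, y, φ, δ, hδ, hG0, hG1, hφ⟩ := exists_vertex_map (K := K) F
  obtain ⟨v₀, -⟩ := exists_coord_pos y
  obtain ⟨n, hn⟩ := exists_nat_one_div_lt hδ
  let t : ℕ → unitInterval := fun j => Set.projIcc 0 1 zero_le_one ((j : ℝ) / (n + 1 : ℕ))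
  have ht0 : t 0 = 0 := by simp [t]
  have htn : t (n + 1) = 1 := by
    have : ((n + 1 : ℕ) : ℝ) / (n + 1 : ℕ) = 1 := div_self (by positivity)
    simp only [t, this]
    exact Set.projIcc_right (zero_le_one (α := ℝ))
  have htj : ∀ j, dist (t (j + 1)) (t j) < δ := by
    intro j
    refine lt_of_le_of_lt ?_ hn
    have := (LipschitzWith.projIcc (zero_le_one (α := ℝ))).dist_le_mul
      (((j + 1 : ℕ) : ℝ) / (n + 1 : ℕ)) ((j : ℝ) / (n + 1 : ℕ))
    refine this.trans (le_of_eq ?_)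
    rw [Real.dist_eq, ← sub_div]
    push_cast
    rw [add_sub_cancel_left, abs_of_nonneg (by positivity), one_mul]
  -- The value `v₀` outside `finitePart K F` is a default and is never used.
  let ψ : ℕ → (F → ℝ) → V := fun j x =>
    if h : x ∈ finitePart K F then φ (⟨x, h⟩, t j) else v₀
  have hψ : ∀ j x (h : x ∈ finitePart K F), ψ j x = φ (⟨x, h⟩, t j) := fun j x h => dif_pos h
  refine ⟨δ, n + 1, ψ, hδ, ?_, ?_, y.1.support, y.2.2.2, ?_⟩
  · intro s x hx hxs
    rw [hψ 0 x hx]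
    have := hφ (⟨x, hx⟩, t 0) (⟨x, hx⟩, t 0) (by rwa [dist_self])
    rw [ht0, hG0, coord_ofFinitePart, extendCoord] at this
    rw [ht0]
    by_contra h
    split_ifs at this with h'
    · exact this.ne' (hxs.2 ⟨_, h'⟩ h)
    · exact lt_irrefl _ this
  · intro j _ l hl
    rcases l with _ | ⟨x₀, l⟩
    · exact ⟨y.1.support, y.2.2.2, by simp⟩
    have hx₀ : x₀ ∈ finitePart K F := hl.1 x₀ (by simp)
    refine ⟨(G (⟨x₀, hx₀⟩, t j)).1.support, (G (⟨x₀, hx₀⟩, t j)).2.2.2, fun x hx => ?_⟩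
    have hx' := hl.1 x hx
    have hd : dist (⟨x₀, hx₀⟩ : finitePart K F) ⟨x, hx'⟩ < δ := hl.2 x₀ (by simp) x hx
    rw [hψ _ x hx', hψ _ x hx']
    refine ⟨mem_support_of_coord_pos (hφ _ _ ?_), mem_support_of_coord_pos (hφ _ _ ?_)⟩
    · rw [Prod.dist_eq]
      exact max_lt hd (by simpa using hδ)
    · rw [Prod.dist_eq]
      exact max_lt hd (by rw [dist_comm]; exact htj j)
  · intro x hx
    rw [hψ _ x hx]
    refine mem_support_of_coord_pos ?_
    rw [← hG1 ⟨x, hx⟩, ← htn]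
    exact hφ _ _ (by rwa [dist_self])

/-- A finite cycle in a complex with contractible realization bounds. -/
theorem exists_bd_eq_of_contractible [ContractibleSpace (GeomRealization K)]
    {c : List V →₀ k} (hc : c ∈ chains k (faceLists K)) (hd : bd c = 0) :
    ∃ b ∈ chains k (faceLists K), bd b = c := by
  classical
  let F : Finset V := c.support.biUnion List.toFinset
  obtain ⟨δ, n, ψ, hδ, hψ0, hψ, s₀, hs₀, hψn⟩ := exists_contiguous_maps (K := K) F
  let A : Set (List V) := {l | (∀ v ∈ l, v ∈ F) ∧ l ∈ faceLists K}
  have hcA : c ∈ chains k A := fun l hl =>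
    ⟨fun v hv => Finset.mem_biUnion.2 ⟨l, hl, List.mem_toFinset.2 hv⟩, hc hl⟩
  have hA : ∀ l ∈ A, ∀ m : List V, m.Sublist l → m ∈ A := fun l hl m hm =>
    ⟨fun v hv => hl.1 v (hm.subset hv), hl.2.imp fun s hs => ⟨hs.1, fun v hv =>
      hs.2 v (hm.subset hv)⟩⟩
  let S : List V → Set (F → ℝ) := fun l => subSimplex F {v | v ∈ l}
  have hS : ∀ l ∈ A, S l ⊆ finitePart K F := fun l hl x hx => by
    obtain ⟨s, hs, h⟩ := hl.2
    exact ⟨s, hs, hx.1, fun v hv => hx.2 v fun h' => hv (h _ h')⟩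
  have hsmall : ∀ {N N' : Set (F → ℝ)}, N ⊆ N' → smallLists N δ ⊆ smallLists N' δ :=
    fun h l hl => ⟨fun x hx => h (hl.1 x hx), hl.2⟩
  have hnil : Finsupp.single [] 1 ∈ chains k (smallLists (S []) δ) :=
    single_mem_chains (A := smallLists (S []) δ) ⟨by simp, by simp⟩ 1
  -- With `r = 0` and `ε = 1` the lift is a chain map. It sends a simplex to small lists of points
  -- of that simplex, as an iterated subdivision would.
  obtain ⟨sd, hsd_nil, hsd, hbdsd⟩ := exists_lift (k := k) A
    (fun l => chains k (smallLists (S l) δ))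
    0 1 (Finsupp.single [] 1) hA
    (fun l _ m hm => Finsupp.supported_mono (hsmall fun x hx =>
      ⟨hx.1, fun v hv => hx.2 v fun h => hv (hm.subset h)⟩))
    (fun l hl hl0 c hc hd => exists_bd_eq_of_convex (convex_subSimplex F _)
      (isBounded_subSimplex F _) (by
        obtain ⟨v, hv⟩ := List.exists_mem_of_ne_nil l hl0
        refine ⟨Pi.single ⟨v, hl.1 v hv⟩ 1, single_mem_stdSimplex ℝ _, fun w hw => ?_⟩
        refine Pi.single_eq_of_ne (fun h => hw ?_) _
        rw [h]
        exact hv) hδ hc hd)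
    (fun _ _ _ => Submodule.zero_mem _) (fun _ _ => by simp)
    hnil (by simp)
  simp only [LinearMap.zero_apply, zero_add, one_smul] at hbdsd
  have hz : sd c ∈ chains k (smallLists (finitePart K F) δ) :=
    map_mem_of_forall_single _ _ (fun l hl =>
      Finsupp.supported_mono (hsmall (hS l hl)) (hsd l hl)) hcA
  have hzd : bd (sd c) = 0 := by rw [hbdsd c hcA, hd, map_zero]
  -- With `ε = -1` the lift is a chain homotopy from the identity to `map (ψ 0) ∘ₗ sd`; the carrier
  -- of `l` is a full simplex, acyclic by coning from a vertex of `l`.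
  obtain ⟨h, -, hh, hbdh⟩ := exists_lift (k := k) A (fun l => chains k {m | ∀ v ∈ m, v ∈ l})
    (map (ψ 0) ∘ₗ sd - LinearMap.id) (-1) 0 hA
    (fun l _ m hm => Finsupp.supported_mono fun p hp v hv => hm.subset (hp v hv))
    (fun l hl hl0 c hc hd => by
      obtain ⟨v, hv⟩ := List.exists_mem_of_ne_nil l hl0
      refine exists_bd_eq_of_cone (A := {m | ∀ w ∈ m, w ∈ l}) (v := v) (fun m hm w hw => ?_) hc hd
      rcases List.mem_cons.1 hw with rfl | hw
      exacts [hv, hm w hw])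
    (fun l hl _ => Submodule.sub_mem _ (map_mem_chains (B := {m | ∀ v ∈ m, v ∈ l})
      (fun m hm v hv => by
      obtain ⟨x, hx, rfl⟩ := List.mem_map.1 hv
      exact hψ0 _ x (hS l hl (hm.1 x hx)) (hm.1 x hx)) (hsd l hl))
      (single_mem_chains (A := {m | ∀ v ∈ m, v ∈ l}) (fun v hv => hv) _))
    (fun l hl => by
      have := hbdsd (Finsupp.single l 1) (single_mem_chains hl 1)
      simp [bd_map, this, bd_single])
    (Submodule.zero_mem _) (by simp [hsd_nil])
  obtain ⟨b₂, hb₂, hbd₂⟩ := exists_bd_eq_map_sub_map_of_chain (B := faceLists K) (f := ψ) (n := n)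
    (fun j hj l hl m hm => by
      obtain ⟨s, hs, h⟩ := hψ j hj l hl
      refine ⟨s, hs, fun v hv => ?_⟩
      obtain ⟨x, hx, rfl | rfl⟩ := hm v hv
      exacts [(h x hx).1, (h x hx).2]) hz hzd
  obtain ⟨v₁, hv₁⟩ := (K.isRelLowerSet_faces hs₀).1
  obtain ⟨b₃, hb₃, hbd₃⟩ := exists_bd_eq_of_cone (k := k) (A := {l | ∀ v ∈ l, v ∈ s₀}) (v := v₁)
    (c := map (ψ n) (sd c)) (fun l hl v hv => by
      rcases List.mem_cons.1 hv with rfl | hv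
      exacts [hv₁, hl v hv]) (map_mem_chains (B := {l | ∀ v ∈ l, v ∈ s₀}) (fun l hl v hv => by
      obtain ⟨x, hx, rfl⟩ := List.mem_map.1 hv
      exact hψn x (hl.1 x hx)) hz) (by rw [bd_map, hzd, map_zero])
  have hb₃' : b₃ ∈ chains k (faceLists K) :=
    Finsupp.supported_mono (show {l | ∀ v ∈ l, v ∈ s₀} ⊆ faceLists K from
      fun l hl => ⟨s₀, hs₀, hl⟩) hb₃
  have hhc : h c ∈ chains k (faceLists K) := map_mem_of_forall_single _ _ (fun l hl =>
    Finsupp.supported_mono (show {m | ∀ v ∈ m, v ∈ l} ⊆ faceLists K from fun m hm =>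
      hl.2.imp fun s hs => ⟨hs.1, fun v hv => hs.2 v (hm v hv)⟩) (hh l hl)) hcA
  -- The three boundaries telescope: `b₃` fills `map (ψ n) (sd c)`, `b₂` joins it to `map (ψ 0) (sd
  -- c)`, and `h c` joins that to `c`.
  refine ⟨b₃ - b₂ - h c, Submodule.sub_mem _ (Submodule.sub_mem _ hb₃' hb₂) hhc, ?_⟩
  have := hbdh c hcA
  rw [hd, map_zero, smul_zero, add_zero] at this
  rw [map_sub, map_sub, hbd₃, hbd₂, this]
  simp

end ListChain

/-! ### Vanishing of group cohomology via a projective resolution -/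

open CategoryTheory in
lemma subsingleton_groupCohomology_iff_exactAt {k G : Type u} [CommRing k] [Group G]
    (P : ProjectiveResolution (Rep.trivial k G k)) (A : Rep.{u} k G) (n : ℕ) :
    Subsingleton (groupCohomology A n) ↔ (P.complex.linearYonedaObj k A).ExactAt n := by
  rw [HomologicalComplex.exactAt_iff_isZero_homology, ← ModuleCat.isZero_iff_subsingleton]
  exact (groupCohomologyIso A n P).isZero_iff

open CategoryTheory in
lemma subsingleton_groupCohomology_succ_iff {k G : Type u} [CommRing k] [Group G]
    (P : ProjectiveResolution (Rep.trivial k G k)) (A : Rep.{u} k G) (n : ℕ) :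
    Subsingleton (groupCohomology A (n + 1)) ↔
      ∀ f : P.complex.X (n + 1) ⟶ A, P.complex.d (n + 2) (n + 1) ≫ f = 0 →
        ∃ g : P.complex.X n ⟶ A, P.complex.d (n + 1) n ≫ g = f := by
  rw [subsingleton_groupCohomology_iff_exactAt P,
    HomologicalComplex.exactAt_iff' _ n (n + 1) (n + 2) (by simp) (by simp),
    ShortComplex.moduleCat_exact_iff]
  rfl

open CategoryTheory in
lemma subsingleton_groupCohomology_zero_iff {k G : Type u} [CommRing k] [Group G]
    (P : ProjectiveResolution (Rep.trivial k G k)) (A : Rep.{u} k G) :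
    Subsingleton (groupCohomology A 0) ↔
      ∀ f : P.complex.X 0 ⟶ A, P.complex.d 1 0 ≫ f = 0 → f = 0 := by
  rw [subsingleton_groupCohomology_iff_exactAt P,
    HomologicalComplex.exactAt_iff' _ 0 0 1 (by simp) (by simp),
    ShortComplex.moduleCat_exact_iff]
  -- The predecessor of degree 0 is taken to be 0 itself, so the incoming map is `d 0 0`, which
  -- vanishes.
  have h : (P.complex.linearYonedaObj k A).d 0 0 = 0 :=
    HomologicalComplex.shape _ _ _ (by simp)
  constructor
  · intro H f hf
    obtain ⟨g, hg⟩ := H f hf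
    have : ((P.complex.linearYonedaObj k A).d 0 0).hom g = f := hg
    rw [h] at this
    exact this.symm
  · intro H f hf
    exact ⟨0, by rw [map_zero]; exact (H f hf).symm⟩

/-! ### Free actions on lists and the resulting resolution -/

namespace ListChain

section Action

variable {G V : Type*} [Group G] [MulAction G V]

/-- The diagonal action on lists. -/
def act (g : G) (l : List V) : List V := l.map (g • ·)

@[simp] lemma act_one (l : List V) : act (1 : G) l = l := by simp [act]

lemma act_mul (g h : G) (l : List V) : act (g * h) l = act g (act h l) := by
  simp [act, mul_smul]

@[simp] lemma length_act (g : G) (l : List V) : (act g l).length = l.length := by simp [act]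

/-- The orbit relation on lists. -/
def actSetoid (G V : Type*) [Group G] [MulAction G V] : Setoid (List V) where
  r l m := ∃ g : G, act g l = m
  iseqv :=
    ⟨fun l => ⟨1, by simp⟩, fun {l m} ⟨g, h⟩ => ⟨g⁻¹, by simp [← h, ← act_mul]⟩,
      fun {l m p} ⟨g, h⟩ ⟨g', h'⟩ => ⟨g' * g, by rw [act_mul, h, h']⟩⟩

/-- A representative of the orbit of a list. -/
noncomputable def orbitRep (G : Type*) {V : Type*} [Group G] [MulAction G V] (l : List V) :
    List V :=
  (Quotient.mk (actSetoid G V) l).out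

lemma exists_act_orbitRep (l : List V) : ∃ g : G, act g (orbitRep G l) = l :=
  Quotient.exact (s := actSetoid G V) (Quotient.out_eq _)

/-- The group element which moves the representative of the orbit of a list to the list. -/
noncomputable def orbitElt (G : Type*) {V : Type*} [Group G] [MulAction G V] (l : List V) : G :=
  (exists_act_orbitRep l).choose

lemma act_orbitElt (l : List V) : act (orbitElt G l) (orbitRep G l) = l :=
  (exists_act_orbitRep l).choose_spec

lemma orbitRep_act (g : G) (l : List V) : orbitRep G (act g l) = orbitRep G l := by
  have : Quotient.mk (actSetoid G V) (act g l) = Quotient.mk (actSetoid G V) l :=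
    (Quotient.sound (s := actSetoid G V) ⟨g, rfl⟩).symm
  rw [orbitRep, this, orbitRep]

lemma orbitRep_eq (l : List V) : orbitRep G l = act (orbitElt G l)⁻¹ l := by
  conv_rhs => rw [← act_orbitElt (G := G) l, ← act_mul]
  rw [act_orbitElt, inv_mul_cancel, act_one]

/-- The representation of `G` on the chains of lists. -/
noncomputable def rep (k G V : Type*) [CommRing k] [Group G] [MulAction G V] :
    Representation k G (List V →₀ k) where
  toFun g := map (g • ·)
  map_one' := by ext1 l; ext1; simp
  map_mul' g h := by ext1 l; ext1; simp [mul_smul, Function.comp_def]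

lemma rep_apply {k : Type*} [CommRing k] (g : G) (c : List V →₀ k) :
    rep k G V g c = map (g • ·) c := rfl

lemma rep_single {k : Type*} [CommRing k] (g : G) (l : List V) (a : k) :
    rep k G V g (Finsupp.single l a) = Finsupp.single (act g l) a := by
  simp [rep_apply, act]

/-- The lists of `L` of length `n`. -/
def level (L : Set (List V)) (n : ℕ) : Set (List V) := {l | l ∈ L ∧ l.length = n}

/-- A set of lists which is closed under sublists and on which `G` acts freely, and whose chain
complex is acyclic. -/
structure IsFreeAcyclic (k G : Type*) {V : Type*} [CommRing k] [Group G] [MulAction G V]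
    (L : Set (List V)) : Prop where
  nil_mem : [] ∈ L
  sublist : ∀ l ∈ L, ∀ m : List V, m.Sublist l → m ∈ L
  act_mem : ∀ g : G, ∀ l ∈ L, act g l ∈ L
  free : ∀ g : G, ∀ l ∈ L, l ≠ [] → act g l = l → g = 1
  acyclic : ∀ c ∈ chains k L, bd c = 0 → ∃ b ∈ chains k L, bd b = c

end Action

namespace IsFreeAcyclic

section

variable {k G V : Type*} [CommRing k] [Group G] [MulAction G V] {L : Set (List V)}

lemma act_mem_level (hL : IsFreeAcyclic k G L) (g : G) {n : ℕ} {l : List V} (hl : l ∈ level L n) :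
    act g l ∈ level L n :=
  ⟨hL.act_mem g l hl.1, by rw [length_act]; exact hl.2⟩

lemma orbitRep_mem_level (hL : IsFreeAcyclic k G L) {n : ℕ} {l : List V} (hl : l ∈ level L n) :
    orbitRep G l ∈ level L n := by
  rw [orbitRep_eq]
  exact hL.act_mem_level _ hl

/-- Both elements move the same representative to `act g l`, so freeness identifies them. The level
`n + 1` excludes the empty list, which every element fixes. -/
lemma orbitElt_act (hL : IsFreeAcyclic k G L) (g : G) {n : ℕ} {l : List V}
    (hl : l ∈ level L (n + 1)) :
    orbitElt G (act g l) = g * orbitElt G l := by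
  have h := act_orbitElt (G := G) (act g l)
  rw [orbitRep_act] at h
  have h' : act ((g * orbitElt G l)⁻¹ * orbitElt G (act g l)) (orbitRep G l) = orbitRep G l := by
    rw [act_mul, h, mul_inv_rev, act_mul, ← act_mul g⁻¹, inv_mul_cancel, act_one, ← orbitRep_eq]
  have hr := hL.orbitRep_mem_level hl
  have := hL.free _ _ hr.1 (fun h0 => by simpa [h0] using hr.2) h'
  rw [inv_mul_eq_one] at this
  exact this.symm

/-- Extension of a function on representatives of orbits to an equivariant function. -/
lemma equivariant_extend (hL : IsFreeAcyclic k G L) {E : Type*} [AddCommGroup E] [Module k E]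
    (σ : Representation k G E) (f : List V → E) (g : G) {n : ℕ} {l : List V} (hl : l ∈ level L (n + 1)) :
    σ (orbitElt G (act g l)) (f (orbitRep G (act g l))) =
      σ g (σ (orbitElt G l) (f (orbitRep G l))) := by
  rw [hL.orbitElt_act g hl, orbitRep_act, map_mul]
  rfl

lemma bd_mem_level (hL : IsFreeAcyclic k G L) {n : ℕ} {c : List V →₀ k}
    (hc : c ∈ chains k (level L (n + 1))) :
    bd c ∈ chains k (level L n) :=
  bd_mem_chains (A := level L (n + 1)) (B := level L n)
    (fun l hl m hm h => ⟨hL.sublist l hl.1 m hm, by have := hl.2; omega⟩) hc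

/-- A filling given by acyclicity may mix lengths. The boundary lowers length by exactly one, so the
part of length `n + 1` is already a filling. -/
lemma exists_bd_eq_level (hL : IsFreeAcyclic k G L) {n : ℕ} {c : List V →₀ k}
    (hc : c ∈ chains k (level L n))
    (hd : bd c = 0) : ∃ b ∈ chains k (level L (n + 1)), bd b = c := by
  classical
  obtain ⟨b, hb, rfl⟩ := hL.acyclic c (Finsupp.supported_mono (fun l hl => hl.1) hc) hd
  refine ⟨b.filter (fun l => l.length = n + 1), fun l hl => ?_, ?_⟩
  · rw [Finset.mem_coe, Finsupp.support_filter, Finset.mem_filter] at hl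
    exact ⟨hb hl.1, hl.2⟩
  · have key : ∀ b : List V →₀ k, bd (b.filter (fun l => l.length = n + 1)) =
        (bd b).filter (fun l => l.length = n) := by
      intro b
      induction b using Finsupp.induction_linear with
      | zero => rw [Finsupp.filter_zero, map_zero, Finsupp.filter_zero]
      | add f g hf hg => simp only [Finsupp.filter_add, map_add, hf, hg]
      | single l a =>
        have h := bdList_mem_chains (k := k) l
        rw [bd_single]
        by_cases hl : l.length = n + 1
        · rw [Finsupp.filter_single_of_pos (fun l : List V => l.length = n + 1) hl, bd_single,
            Finsupp.filter_smul,
            (Finsupp.filter_eq_self_iff _ _).2 fun m hm => ?_]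
          have := (h (Finsupp.mem_support_iff.2 hm)).2
          omega
        · rw [Finsupp.filter_single_of_neg (fun l : List V => l.length = n + 1) hl, map_zero,
            Finsupp.filter_smul,
            (Finsupp.filter_eq_zero_iff _ _).2 fun m hm => ?_, smul_zero]
          by_contra hm0
          have := (h (Finsupp.mem_support_iff.2 hm0)).2
          omega
    rw [key]
    exact (Finsupp.filter_eq_self_iff _ _).2 fun m hm => (hc (Finsupp.mem_support_iff.2 hm)).2

end

section

open CategoryTheory

variable {k G V : Type u} [CommRing k] [Group G] [MulAction G V] {L : Set (List V)}
  (hL : IsFreeAcyclic k G L)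

/-- The representation on the `n`-chains. -/
noncomputable abbrev obj (n : ℕ) : Rep.{u} k G :=
  (Rep.of (rep k G V)).subrepresentation (chains k (level L (n + 1))) fun g _ hc =>
    map_mem_chains (fun _ hl => hL.act_mem_level g hl) hc

/-- The boundary map as a map of representations. -/
noncomputable def diff (n : ℕ) : hL.obj (n + 1) ⟶ hL.obj n :=
  Rep.ofHom ⟨bd.restrict fun _ hc => hL.bd_mem_level hc, fun g => by
    ext1 c; exact Subtype.ext (bd_map _ _)⟩

/-- The augmentation. -/
noncomputable def aug : hL.obj 0 ⟶ Rep.trivial k G k :=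
  Rep.ofHom ⟨Finsupp.lapply [] ∘ₗ bd ∘ₗ Submodule.subtype _, fun g => by
    ext1 c
    have h : bd c.1 ∈ chains k (level L 0) := hL.bd_mem_level c.2
    have : map (g • ·) (bd c.1) = bd c.1 := by
      have := eq_of_forall_single (map (g • ·)) LinearMap.id (fun l hl => by
        have h0 : l = [] := List.length_eq_zero_iff.1 hl.2
        simp [h0]) h
      simpa using this
    change (bd (map (g • ·) c.1)) [] = bd c.1 []
    rw [bd_map, this]⟩

lemma aug_apply (c : hL.obj 0) : hL.aug.hom c = bd c.1 [] := rfl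

/-- The chain complex of representations. -/
noncomputable def complex : ChainComplex (Rep.{u} k G) ℕ :=
  ChainComplex.of hL.obj hL.diff fun n => by
    refine Rep.hom_ext (Representation.IntertwiningMap.ext (LinearMap.ext fun c =>
      Subtype.ext ?_))
    exact bd_bd c.1

lemma complex_d (n : ℕ) : hL.complex.d (n + 1) n = hL.diff n := by
  simp [complex]

/-- The map of representations given by an equivariant function. -/
noncomputable def homMk (A : Rep.{u} k G) (n : ℕ) (f : List V → A)
    (hf : ∀ g : G, ∀ l ∈ level L (n + 1), f (act g l) = A.ρ g (f l)) : hL.obj n ⟶ A :=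
  Rep.ofHom ⟨Finsupp.linearCombination k f ∘ₗ Submodule.subtype _, fun g => by
    ext1 c
    exact eq_of_forall_single (Finsupp.linearCombination k f ∘ₗ map (g • ·))
      (A.ρ g ∘ₗ Finsupp.linearCombination k f) (fun l hl => by
        simpa [act] using hf g l hl) c.2⟩

/-- A basis element of the `n`-chains. -/
noncomputable def basisElt (n : ℕ) (l : List V) (hl : l ∈ level L (n + 1)) : hL.obj n :=
  ⟨Finsupp.single l 1, single_mem_chains hl 1⟩

open Classical in
/-- The function on lists defined by a map of representations. -/
noncomputable def toFun {A : Rep.{u} k G} {n : ℕ} (f : hL.obj n ⟶ A) (l : List V) : A :=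
  if hl : l ∈ level L (n + 1) then f.hom (hL.basisElt n l hl) else 0

lemma toFun_of_mem {A : Rep.{u} k G} {n : ℕ} (f : hL.obj n ⟶ A) {l : List V}
    (hl : l ∈ level L (n + 1)) : hL.toFun f l = f.hom (hL.basisElt n l hl) :=
  dif_pos hl

lemma toFun_act {A : Rep.{u} k G} {n : ℕ} (f : hL.obj n ⟶ A) (g : G) (l : List V)
    (hl : l ∈ level L (n + 1)) : hL.toFun f (act g l) = A.ρ g (hL.toFun f l) := by
  rw [hL.toFun_of_mem f hl, hL.toFun_of_mem f (hL.act_mem_level g hl), ← Rep.hom_comm_apply]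
  exact congrArg _ (Subtype.ext (rep_single g l 1).symm)

lemma homMk_toFun {A : Rep.{u} k G} {n : ℕ} (f : hL.obj n ⟶ A) :
    hL.homMk A n (hL.toFun f) (hL.toFun_act f) = f := by
  ext c
  change Finsupp.linearCombination k (hL.toFun f) c.1 = f.hom c
  classical
  -- Precomposing with the restriction extends `f` to all chains, so that it can be compared on
  -- single lists.
  have h := eq_of_forall_single (f.hom.toLinearMap ∘ₗ Finsupp.restrictDom k k (level L (n + 1)))
    (Finsupp.linearCombination k (hL.toFun f)) (fun l hl => by
      simp only [LinearMap.comp_apply, Finsupp.linearCombination_single, one_smul,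
        hL.toFun_of_mem f hl]
      exact congrArg f.hom (Subtype.ext
        (Finsupp.filter_single_of_pos (· ∈ level L (n + 1)) hl))) c.2
  rw [← h]
  exact congrArg f.hom (Subtype.ext
    ((Finsupp.filter_eq_self_iff (· ∈ level L (n + 1)) _).2 fun l hl =>
      c.2 (Finsupp.mem_support_iff.2 hl)))

/-- The chains are free over the group ring on orbit representatives: preimages are chosen on these
and extended equivariantly. -/
instance projective_obj (n : ℕ) : Projective (hL.obj n) where
  factors {A B} f e he := by
    rw [Rep.epi_iff_surjective] at he
    choose s hs using he
    let a : List V → A := fun l => s (hL.toFun f l)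
    refine ⟨hL.homMk A n (fun l => A.ρ (orbitElt G l) (a (orbitRep G l))) fun g l hl =>
      hL.equivariant_extend A.ρ a g hl, ?_⟩
    rw [← hL.homMk_toFun f]
    ext c
    refine eq_of_forall_single (e.hom.toLinearMap ∘ₗ Finsupp.linearCombination k _)
      (Finsupp.linearCombination k _) (fun l hl => ?_) c.2
    simp only [LinearMap.comp_apply, Finsupp.linearCombination_single, one_smul]
    change e.hom (A.ρ _ _) = _
    rw [Rep.hom_comm_apply, hs, ← hL.toFun_act f _ _ (hL.orbitRep_mem_level hl), act_orbitElt]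

/-- The augmentation as a map of complexes. -/
noncomputable def augComplex :
    hL.complex ⟶ (ChainComplex.single₀ (Rep.{u} k G)).obj (Rep.trivial k G k) :=
  (hL.complex.toSingle₀Equiv _).symm ⟨hL.aug, by
    rw [complex_d]
    ext c
    exact congrArg (· []) (bd_bd c.1)⟩

lemma aug_surjective : Function.Surjective hL.aug.hom := by
  intro a
  obtain ⟨b, hb, hbd⟩ := hL.exists_bd_eq_level (n := 0) (c := Finsupp.single [] a)
    (single_mem_chains (A := level L 0) ⟨hL.nil_mem, rfl⟩ _) (by simp)
  refine ⟨⟨b, hb⟩, ?_⟩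
  rw [aug_apply, hbd]
  simp

lemma exists_diff_eq_of_aug (c : hL.obj 0) (hc : hL.aug.hom c = 0) :
    ∃ b, (hL.diff 0).hom b = c := by
  obtain ⟨b, hb, h⟩ := hL.exists_bd_eq_level c.2 (by
    have h : bd c.1 ∈ chains k (level L 0) := hL.bd_mem_level c.2
    ext l
    by_cases hl : l = []
    · subst hl; exact hc
    · by_contra h0
      exact hl (List.length_eq_zero_iff.1 (h (Finsupp.mem_support_iff.2 h0)).2))
  exact ⟨⟨b, hb⟩, Subtype.ext h⟩

lemma exists_diff_eq {n : ℕ} (c : hL.obj (n + 1)) (hc : (hL.diff n).hom c = 0) :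
    ∃ b, (hL.diff (n + 1)).hom b = c := by
  obtain ⟨b, hb, h⟩ := hL.exists_bd_eq_level c.2 (congrArg Subtype.val hc)
  exact ⟨⟨b, hb⟩, Subtype.ext h⟩

/-- Exactness is reflected by the forgetful functor to modules, where it is the acyclicity of lists,
length by length. -/
instance quasiIso_augComplex : QuasiIso hL.augComplex where
  quasiIsoAt m := by
    induction m with
    | zero =>
      rw [ChainComplex.quasiIsoAt₀_iff, ShortComplex.quasiIso_iff_of_zeros' _ rfl rfl rfl]
      constructor
      · apply (forget₂ _ (ModuleCat k)).reflects_exact_of_faithful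
        rw [ShortComplex.moduleCat_exact_iff]
        intro c hc
        obtain ⟨b, hb⟩ := hL.exists_diff_eq_of_aug c (by simpa [augComplex] using! hc)
        exact ⟨b, by simpa [complex_d] using! hb⟩
      · rw [Rep.epi_iff_surjective]
        intro a
        obtain ⟨b, hb⟩ := hL.aug_surjective a
        exact ⟨b, by simpa [augComplex] using! hb⟩
    | succ m _ =>
      rw [quasiIsoAt_iff_exactAt' (hL := ChainComplex.exactAt_succ_single_obj ..),
          HomologicalComplex.exactAt_iff' _ (m + 2) (m + 1) m (by simp) (by simp)]
      apply (forget₂ _ (ModuleCat k)).reflects_exact_of_faithful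
      rw [ShortComplex.moduleCat_exact_iff]
      intro c hc
      have hc' : (hL.complex.d (m + 1) m).hom c = 0 := hc
      rw [complex_d] at hc'
      obtain ⟨b, hb⟩ := hL.exists_diff_eq c hc'
      rw [← complex_d] at hb
      exact ⟨b, hb⟩

/-- The projective resolution of the trivial representation by chains of lists. -/
noncomputable def resolution : ProjectiveResolution (Rep.trivial k G k) where
  complex := hL.complex
  projective n := hL.projective_obj n
  π := hL.augComplex

/-- Equivariance of a function on the lists of length `n`. -/
abbrev Equivariant {E : Type*} [AddCommGroup E] [Module k E] (σ : Representation k G E)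
    (L : Set (List V)) (n : ℕ) (f : List V → E) : Prop :=
  ∀ g : G, ∀ l ∈ level L n, f (act g l) = σ g (f l)

lemma diff_comp_homMk (A : Rep.{u} k G) (n : ℕ) (f : List V → A)
    (hf : ∀ g : G, ∀ l ∈ level L (n + 1), f (act g l) = A.ρ g (f l)) (l : List V)
    (hl : l ∈ level L (n + 2)) :
    (hL.diff n ≫ hL.homMk A n f hf).hom (hL.basisElt (n + 1) l hl) =
      Finsupp.linearCombination k f (bdList k l) := by
  change Finsupp.linearCombination k f (bd (Finsupp.single l 1)) = _
  rw [bd_single, one_smul]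

lemma hom_ext_basisElt {A : Rep.{u} k G} {n : ℕ} {f f' : hL.obj n ⟶ A}
    (h : ∀ l (hl : l ∈ level L (n + 1)),
      f.hom (hL.basisElt n l hl) = f'.hom (hL.basisElt n l hl)) : f = f' := by
  have : hL.toFun f = hL.toFun f' := by
    funext l
    by_cases hl : l ∈ level L (n + 1)
    · rw [hL.toFun_of_mem f hl, hL.toFun_of_mem f' hl, h l hl]
    · rw [toFun, toFun, dif_neg hl, dif_neg hl]
  rw [← hL.homMk_toFun f, ← hL.homMk_toFun f']
  congr 1

lemma homMk_basisElt (A : Rep.{u} k G) (n : ℕ) (f : List V → A)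
    (hf : ∀ g : G, ∀ l ∈ level L (n + 1), f (act g l) = A.ρ g (f l)) (l : List V)
    (hl : l ∈ level L (n + 1)) : (hL.homMk A n f hf).hom (hL.basisElt n l hl) = f l := by
  change Finsupp.linearCombination k f (Finsupp.single l 1) = _
  simp

/-- The cohomology in positive degrees in terms of equivariant functions on lists. -/
theorem subsingleton_groupCohomology_succ_iff (hL : IsFreeAcyclic k G L) (A : Rep.{u} k G) (n : ℕ) :
    Subsingleton (groupCohomology A (n + 1)) ↔
      ∀ f : List V → A, Equivariant A.ρ L (n + 2) f →
        (∀ l ∈ level L (n + 3), Finsupp.linearCombination k f (bdList k l) = 0) →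
        ∃ h : List V → A, Equivariant A.ρ L (n + 1) h ∧
          ∀ l ∈ level L (n + 2), Finsupp.linearCombination k h (bdList k l) = f l := by
  rw [_root_.subsingleton_groupCohomology_succ_iff hL.resolution]
  change (∀ f : hL.obj (n + 1) ⟶ A, hL.complex.d (n + 2) (n + 1) ≫ f = 0 →
    ∃ g : hL.obj n ⟶ A, hL.complex.d (n + 1) n ≫ g = f) ↔ _
  rw [complex_d, complex_d]
  change (∀ f : hL.obj (n + 1) ⟶ A, hL.diff (n + 1) ≫ f = 0 →
    ∃ g : hL.obj n ⟶ A, hL.diff n ≫ g = f) ↔ _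
  constructor
  · intro H f hf hd
    obtain ⟨g, hg⟩ := H (hL.homMk A (n + 1) f hf) (hL.hom_ext_basisElt fun l hl => by
      rw [diff_comp_homMk, hd l hl]
      rfl)
    refine ⟨hL.toFun g, hL.toFun_act g, fun l hl => ?_⟩
    rw [← hL.diff_comp_homMk A n (hL.toFun g) (hL.toFun_act g) l hl, homMk_toFun, hg,
      homMk_basisElt]
  · intro H f hf
    obtain ⟨h, hh, hd⟩ := H (hL.toFun f) (hL.toFun_act f) (fun l hl => by
      rw [← hL.diff_comp_homMk A (n + 1) (hL.toFun f) (hL.toFun_act f) l hl, homMk_toFun, hf]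
      rfl)
    refine ⟨hL.homMk A n h hh, hL.hom_ext_basisElt fun l hl => ?_⟩
    rw [diff_comp_homMk, hd l hl, hL.toFun_of_mem f hl]

/-- The cohomology in degree zero in terms of equivariant functions on lists. -/
theorem subsingleton_groupCohomology_zero_iff (hL : IsFreeAcyclic k G L) (A : Rep.{u} k G) :
    Subsingleton (groupCohomology A 0) ↔
      ∀ f : List V → A, Equivariant A.ρ L 1 f →
        (∀ l ∈ level L 2, Finsupp.linearCombination k f (bdList k l) = 0) →
        ∀ l ∈ level L 1, f l = 0 := by
  rw [_root_.subsingleton_groupCohomology_zero_iff hL.resolution]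
  change (∀ f : hL.obj 0 ⟶ A, hL.complex.d 1 0 ≫ f = 0 → f = 0) ↔ _
  rw [complex_d]
  change (∀ f : hL.obj 0 ⟶ A, hL.diff 0 ≫ f = 0 → f = 0) ↔ _
  constructor
  · intro H f hf hd l hl
    have h := H (hL.homMk A 0 f hf) (hL.hom_ext_basisElt fun l hl => by
      rw [diff_comp_homMk, hd l hl]
      rfl)
    rw [← hL.homMk_basisElt A 0 f hf l hl, h]
    rfl
  · intro H f hf
    refine hL.hom_ext_basisElt fun l hl => ?_
    rw [← hL.toFun_of_mem f hl, H (hL.toFun f) (hL.toFun_act f) (fun l hl => by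
      rw [← hL.diff_comp_homMk A 0 (hL.toFun f) (hL.toFun_act f) l hl, homMk_toFun, hf]
      rfl) l hl]
    rfl

end

end IsFreeAcyclic

end ListChain

/-! ### Stability of exactness under perturbation -/

section Perturbation

variable {𝕜 W X Y : Type*} [RCLike 𝕜] [NormedAddCommGroup W] [NormedSpace 𝕜 W] [CompleteSpace W]
  [NormedAddCommGroup X] [NormedSpace 𝕜 X]
  [NormedAddCommGroup Y] [NormedSpace 𝕜 Y] [CompleteSpace Y]

/-- An operator with closed range has preimages of controlled norm. -/
lemma exists_preimage_norm_le_of_isClosed_range [CompleteSpace X] (T : X →L[𝕜] Y)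
    (hT : IsClosed (Set.range T)) :
    ∃ C > 0, ∀ x, ∃ x', T x' = T x ∧ ‖x'‖ ≤ C * ‖T x‖ := by
  have hc : IsClosed (T.range : Set Y) := hT
  have : CompleteSpace T.range := hc.completeSpace_coe
  obtain ⟨C, hC, h⟩ := ContinuousLinearMap.exists_preimage_norm_le T.rangeRestrict (by
    rintro ⟨y, x, rfl⟩
    exact ⟨x, rfl⟩)
  refine ⟨C, hC, fun x => ?_⟩
  obtain ⟨x', h1, h2⟩ := h (T.rangeRestrict x)
  exact ⟨x', congrArg Subtype.val h1, h2⟩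

/-- If every vector of the kernel of `B` is approximated by values of `A` up to half its norm,
then the kernel of `B` is contained in the range of `A`. -/
lemma exists_eq_of_approx (A : W →L[𝕜] X) (N : Submodule 𝕜 X) (C : ℝ)
    (h : ∀ z ∈ N, ∃ w, ‖w‖ ≤ C * ‖z‖ ∧ ‖z - A w‖ ≤ 1 / 2 * ‖z‖ ∧ z - A w ∈ N)
    (z : X) (hz : z ∈ N) : ∃ w, A w = z := by
  choose! f hf using h
  -- `s n` is the error after `n` corrections. It stays in `N` and halves each time, so the
  -- corrections sum to a preimage of `z`.
  let s : ℕ → X := fun n => Nat.rec z (fun _ y => y - A (f y)) n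
  have hs : ∀ n, s (n + 1) = s n - A (f (s n)) := fun n => rfl
  have hN : ∀ n, s n ∈ N := fun n => by
    induction n with
    | zero => exact hz
    | succ n ih => rw [hs]; exact (hf _ ih).2.2
  have hnorm : ∀ n, ‖s n‖ ≤ (1 / 2) ^ n * ‖z‖ := fun n => by
    induction n with
    | zero => simp [s]
    | succ n ih =>
      rw [hs, pow_succ]
      refine (hf _ (hN n)).2.1.trans ?_
      linarith
  have hC : ∀ n, ‖f (s n)‖ ≤ (1 / 2) ^ n * (|C| * ‖z‖) := fun n => by
    refine (hf _ (hN n)).1.trans ?_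
    calc C * ‖s n‖ ≤ |C| * ((1 / 2) ^ n * ‖z‖) :=
          mul_le_mul (le_abs_self C) (hnorm n) (norm_nonneg _) (abs_nonneg _)
      _ = _ := by ring
  have hsum : Summable fun n => f (s n) := Summable.of_norm_bounded
    ((summable_geometric_of_lt_one (by norm_num) (by norm_num)).mul_right _) hC
  refine ⟨∑' n, f (s n), ?_⟩
  have h1 : Tendsto (fun n => A (∑ i ∈ Finset.range n, f (s i))) atTop
      (𝓝 (A (∑' n, f (s n)))) := (A.continuous.tendsto _).comp hsum.hasSum.tendsto_sum_nat
  have h2 : ∀ n, A (∑ i ∈ Finset.range n, f (s i)) = z - s n := fun n => by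
    induction n with
    | zero => simp [s]
    | succ n ih => rw [Finset.sum_range_succ, map_add, ih, hs]; abel
  have h3 : Tendsto s atTop (𝓝 0) := by
    refine squeeze_zero_norm hnorm ?_
    simpa using (tendsto_pow_atTop_nhds_zero_of_lt_one (r := (1 / 2 : ℝ)) (by norm_num)
      (by norm_num)).mul_const ‖z‖
  simp only [h2] at h1
  have h4 := tendsto_const_nhds (x := z) |>.sub h3
  rw [sub_zero] at h4
  exact tendsto_nhds_unique h1 h4

/-- Exactness of `W → X → Y` is stable under small perturbations among complexes if the range of
the second map is closed. -/
theorem eventually_exact_of_tendsto [CompleteSpace X] {ι : Type*} {l : Filter ι}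
    {A₀ : W →L[𝕜] X} {B₀ : X →L[𝕜] Y}
    (hAB : ∀ w, B₀ (A₀ w) = 0) (hex : ∀ x, B₀ x = 0 → ∃ w, A₀ w = x)
    (hcl : IsClosed (Set.range B₀)) {A : ι → W →L[𝕜] X} {B : ι → X →L[𝕜] Y}
    (hA : Tendsto A l (𝓝 A₀)) (hB : Tendsto B l (𝓝 B₀)) (hABi : ∀ i w, B i (A i w) = 0) :
    ∀ᶠ i in l, ∀ x, B i x = 0 → ∃ w, A i w = x := by
  have hclA : IsClosed (Set.range A₀) := by
    have : Set.range A₀ = B₀ ⁻¹' {0} := by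
      ext x
      exact ⟨fun ⟨w, hw⟩ => by rw [← hw]; exact hAB w, fun hx => hex x hx⟩
    rw [this]
    exact isClosed_singleton.preimage B₀.continuous
  obtain ⟨C₁, hC₁, h₁⟩ := exists_preimage_norm_le_of_isClosed_range A₀ hclA
  obtain ⟨C₂, hC₂, h₂⟩ := exists_preimage_norm_le_of_isClosed_range B₀ hcl
  have hA' : Tendsto (fun i => ‖A₀ - A i‖) l (𝓝 0) := by
    simpa using (tendsto_const_nhds (x := A₀) |>.sub hA).norm
  have hB' : Tendsto (fun i => ‖B₀ - B i‖) l (𝓝 0) := by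
    simpa using (tendsto_const_nhds (x := B₀) |>.sub hB).norm
  -- This quantity bounds the relative error of one correction; it has to drop to 1/2.
  have hlim : Tendsto (fun i => C₂ * ‖B₀ - B i‖ +
      ‖A₀ - A i‖ * (C₁ * (1 + C₂ * ‖B₀ - B i‖))) l (𝓝 0) := by
    simpa using (hB'.const_mul C₂).add
      (hA'.mul (((hB'.const_mul C₂).const_add 1).const_mul C₁))
  filter_upwards [hlim.eventually_le_const (u := 1 / 2) (by norm_num)] with i hi x hx
  refine exists_eq_of_approx (A i) (LinearMap.ker (B i).toLinearMap) (C₁ * (1 + C₂ * ‖B₀ - B i‖))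
    (fun z hz => ?_) x hx
  have hz : B i z = 0 := hz
  -- Since `B i z = 0`, the vector `B₀ z = (B₀ - B i) z` is small, and so is its preimage `x'`. The
  -- difference `z - x'` lies in the kernel of `B₀`, hence in the range of `A₀`.
  obtain ⟨x', hx', hx'n⟩ := h₂ z
  obtain ⟨w₀, hw₀⟩ := hex (z - x') (by rw [map_sub, hx', sub_self])
  obtain ⟨w, hw, hwn⟩ := h₁ w₀
  rw [hw₀] at hw hwn
  have hBz : ‖B₀ z‖ ≤ ‖B₀ - B i‖ * ‖z‖ := by
    have := (B₀ - B i).le_opNorm z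
    rwa [sub_apply, hz, sub_zero] at this
  have e1 : ‖x'‖ ≤ C₂ * ‖B₀ - B i‖ * ‖z‖ := by
    rw [mul_assoc]
    exact hx'n.trans (mul_le_mul_of_nonneg_left hBz hC₂.le)
  have e2 : ‖w‖ ≤ C₁ * (1 + C₂ * ‖B₀ - B i‖) * ‖z‖ := by
    rw [mul_assoc]
    refine hwn.trans (mul_le_mul_of_nonneg_left ?_ hC₁.le)
    linarith [norm_sub_le z x']
  refine ⟨w, e2, ?_, ?_⟩
  · have : z - A i w = x' + (A₀ - A i) w := by
      rw [sub_apply, hw]; abel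
    rw [this]
    calc ‖x' + (A₀ - A i) w‖ ≤ ‖x'‖ + ‖(A₀ - A i) w‖ := norm_add_le _ _
      _ ≤ C₂ * ‖B₀ - B i‖ * ‖z‖ + ‖A₀ - A i‖ * (C₁ * (1 + C₂ * ‖B₀ - B i‖) * ‖z‖) :=
        add_le_add e1 (((A₀ - A i).le_opNorm w).trans
          (mul_le_mul_of_nonneg_left e2 (norm_nonneg _)))
      _ = (C₂ * ‖B₀ - B i‖ + ‖A₀ - A i‖ * (C₁ * (1 + C₂ * ‖B₀ - B i‖))) * ‖z‖ := by ring
      _ ≤ 1 / 2 * ‖z‖ := mul_le_mul_of_nonneg_right hi (norm_nonneg _)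
  · change B i (z - A i w) = 0
    rw [map_sub, hz, hABi, sub_zero]

end Perturbation

/-! ### From generators to the whole group -/

namespace BoundedRep

variable {𝕜 G E : Type u} [RCLike 𝕜] [Group G] [NormedAddCommGroup E] [NormedSpace 𝕜 E]

/-- Convergence of representations on a generating set implies convergence on the group. -/
lemma tendsto_apply [CompleteSpace E] {S : Finset G} (hS : Subgroup.closure (S : Set G) = ⊤)
    {π : BoundedRep 𝕜 G E} {ι : Type*} {l : Filter ι} {ρ : ι → BoundedRep 𝕜 G E}
    (h : Tendsto (fun i => deformationDist S π (ρ i)) l (𝓝 0)) (g : G) :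
    Tendsto (fun i => (ρ i g : E →L[𝕜] E)) l (𝓝 (π g : E →L[𝕜] E)) := by
  -- In the group of units inversion is continuous, so the closure induction can treat inverses; by
  -- completeness the topology of the units is that of the operator norm.
  suffices H : Tendsto (fun i => ρ i g) l (𝓝 (π g)) from
    (Units.continuous_val.tendsto _).comp H
  have hg : g ∈ Subgroup.closure (S : Set G) := hS ▸ Subgroup.mem_top g
  induction hg using Subgroup.closure_induction with
  | mem s hs =>
    rw [Units.isOpenEmbedding_val.isInducing.tendsto_nhds_iff]
    refine tendsto_iff_norm_sub_tendsto_zero.2 (squeeze_zero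
      (fun _ => norm_nonneg _) (fun i => ?_) h)
    rw [norm_sub_rev]
    exact le_ciSup (f := fun s : S => ‖(π s : E →L[𝕜] E) - (ρ i s : E →L[𝕜] E)‖)
      (Set.finite_range _).bddAbove ⟨s, hs⟩
  | one => simpa using tendsto_const_nhds
  | mul x y _ _ hx hy => simpa using hx.mul hy
  | inv x _ hx => simpa using hx.inv

end BoundedRep

/-! ### Finiteness of orbits and cochains on representatives -/

namespace ListChain

section FaceLists

variable {G V : Type u} [Group G] [MulAction G V] {X : AbstractSimplicialComplex V}

lemma mem_translateFace {g : G} {s : Finset V} {v : V} :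
    v ∈ translateFace g s ↔ ∃ w ∈ s, g • w = v := by
  simp only [translateFace, Finset.mem_map]
  rfl

open Classical in
lemma toFinset_act (g : G) (l : List V) : (act g l).toFinset = translateFace g l.toFinset := by
  ext v
  simp [mem_translateFace, act]

open Classical in
lemma toFinset_mem_faces {l : List V} (hl : l ∈ faceLists X) (h0 : l ≠ []) :
    l.toFinset ∈ X.faces := by
  obtain ⟨s, hs, h⟩ := hl
  exact (X.isRelLowerSet_faces hs).2 (fun v hv => h v (List.mem_toFinset.1 hv))
    (List.toFinset_nonempty_iff l |>.2 h0)

lemma isFreeAcyclic_faceLists (k : Type*) [CommRing k] [ContractibleSpace (GeomRealization X)]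
    (hinv : ∀ g : G, ∀ s ∈ X.faces, translateFace g s ∈ X.faces)
    (hfree : ∀ g : G, ∀ s ∈ X.faces, translateFace g s = s → g = 1) :
    IsFreeAcyclic k G (faceLists X) where
  nil_mem := by
    obtain ⟨x⟩ : Nonempty (GeomRealization X) := inferInstance
    exact ⟨x.1.support, x.2.2.2, by simp⟩
  sublist := fun l ⟨s, hs, h⟩ m hm => ⟨s, hs, fun v hv => h v (hm.subset hv)⟩
  act_mem := fun g l ⟨s, hs, h⟩ => ⟨translateFace g s, hinv g s hs, fun v hv => by
    obtain ⟨w, hw, rfl⟩ := List.mem_map.1 hv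
    exact mem_translateFace.2 ⟨w, h w hw, rfl⟩⟩
  free := fun g l hl h0 h => by
    classical
    refine hfree g _ (toFinset_mem_faces hl h0) ?_
    rw [← toFinset_act, h]
  acyclic := fun c hc hd => exists_bd_eq_of_contractible hc hd

/-- Every such list has a translate with entries in the finite union of the members of `T`. Entries
may repeat, so the underlying face may have any dimension up to `m`. -/
lemma finite_orbitReps {m n : ℕ} (hmn : m ≤ n) {T : Set (Finset V)} (hT : T.Finite)
    (h : ∀ s ∈ X.faces, s.card ≤ n + 1 → ∃ t ∈ T, ∃ g : G, translateFace g t = s) :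
    (orbitRep G '' level (faceLists X) (m + 1)).Finite := by
  classical
  let U : Set V := ⋃ t ∈ T, (t : Set V)
  have hU : U.Finite := hT.biUnion fun t _ => t.finite_toSet
  have := hU.to_subtype
  refine ((List.finite_length_eq U (m + 1)).image
    fun l => orbitRep G (l.map Subtype.val)).subset ?_
  rintro _ ⟨l, hl, rfl⟩
  have h0 : l ≠ [] := fun h0 => by simpa [h0] using hl.2
  obtain ⟨t, ht, g, hg⟩ := h _ (toFinset_mem_faces hl.1 h0)
    ((List.toFinset_card_le l).trans (by have := hl.2; omega))
  have hmem : ∀ v ∈ act g⁻¹ l, v ∈ U := by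
    intro v hv
    obtain ⟨w, hw, rfl⟩ := List.mem_map.1 hv
    rw [← List.mem_toFinset, ← hg, mem_translateFace] at hw
    obtain ⟨v, hvt, rfl⟩ := hw
    rw [inv_smul_smul]
    exact Set.mem_biUnion ht hvt
  refine ⟨(act g⁻¹ l).attach.map fun v => ⟨v.1, hmem v.1 v.2⟩, by simpa using hl.2, ?_⟩
  simp only [List.map_map, Function.comp_def]
  rw [List.attach_map_subtype_val, orbitRep_act]

end FaceLists

section Cochains

variable {𝕜 G E : Type u} {V : Type u} [RCLike 𝕜] [Group G] [NormedAddCommGroup E]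
  [NormedSpace 𝕜 E] [MulAction G V]

/-- The representatives of the orbits of the lists of length `m`. -/
abbrev Reps (G : Type*) {V : Type*} [Group G] [MulAction G V] (L : Set (List V)) (m : ℕ) :=
  ↥(orbitRep G '' level L m)

variable (L : Set (List V)) (m : ℕ) (ρ : BoundedRep 𝕜 G E)

open Classical in
/-- Evaluation at a list of the equivariant extension of a function on representatives. -/
noncomputable def evalExt (l : List V) : (Reps G L m → E) →L[𝕜] E :=
  if h : orbitRep G l ∈ orbitRep G '' level L m then
    (ρ (orbitElt G l) : E →L[𝕜] E) ∘L
      ContinuousLinearMap.proj (R := 𝕜) (φ := fun _ : Reps G L m => E) ⟨orbitRep G l, h⟩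
  else 0

/-- The coboundary operator on functions on representatives. -/
noncomputable def coboundary : (Reps G L m → E) →L[𝕜] (Reps G L (m + 1) → E) :=
  ContinuousLinearMap.pi fun r => Finsupp.linearCombination 𝕜 (evalExt L m ρ) (bdList 𝕜 r.1)

variable {L m ρ}

lemma evalExt_apply {l : List V} (hl : l ∈ level L m) (x : Reps G L m → E) :
    evalExt L m ρ l x = ρ.toRepresentation (orbitElt G l) (x ⟨orbitRep G l, l, hl, rfl⟩) := by
  have h : orbitRep G l ∈ orbitRep G '' level L m := ⟨l, hl, rfl⟩
  rw [evalExt, dif_pos h]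
  rfl

lemma coboundary_apply (x : Reps G L m → E) (r : Reps G L (m + 1)) :
    coboundary L m ρ x r =
      Finsupp.linearCombination 𝕜 (fun l => evalExt L m ρ l x) (bdList 𝕜 r.1) := by
  simp [coboundary, Finsupp.linearCombination_apply, Finsupp.sum]

lemma orbitRep_orbitRep (l : List V) : orbitRep G (orbitRep G l) = orbitRep G l := by
  conv_lhs => rw [orbitRep_eq (G := G) l, orbitRep_act]

lemma orbitRep_of_reps (r : Reps G L m) : orbitRep G r.1 = r.1 := by
  obtain ⟨_, l, hl, rfl⟩ := r
  exact orbitRep_orbitRep l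

lemma IsFreeAcyclic.mem_level_of_reps (hL : IsFreeAcyclic 𝕜 G L) (r : Reps G L m) :
    r.1 ∈ level L m := by
  obtain ⟨_, l, hl, rfl⟩ := r
  exact hL.orbitRep_mem_level hl

/-- A representative represents itself, so this element fixes it and is trivial by freeness. -/
lemma IsFreeAcyclic.orbitElt_of_reps (hL : IsFreeAcyclic 𝕜 G L) (r : Reps G L (m + 1)) :
    orbitElt G r.1 = 1 := by
  have hr := hL.mem_level_of_reps r
  refine hL.free _ _ hr.1 (fun h0 => by simpa [h0] using hr.2) ?_
  conv_lhs => rw [← orbitRep_of_reps r, orbitRep_of_reps r]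
  conv_rhs => rw [← act_orbitElt (G := G) r.1, orbitRep_of_reps r]

lemma IsFreeAcyclic.equivariant_evalExt (hL : IsFreeAcyclic 𝕜 G L) (x : Reps G L (m + 1) → E) :
    IsFreeAcyclic.Equivariant ρ.toRepresentation L (m + 1)
      (fun l => evalExt L (m + 1) ρ l x) := by
  intro g l hl
  simp only [evalExt_apply hl, evalExt_apply (hL.act_mem_level g hl), orbitRep_act,
    hL.orbitElt_act g hl, map_mul]
  rfl

lemma IsFreeAcyclic.evalExt_of_reps (hL : IsFreeAcyclic 𝕜 G L) (x : Reps G L (m + 1) → E)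
    (r : Reps G L (m + 1)) : evalExt L (m + 1) ρ r.1 x = x r := by
  have h : (⟨orbitRep G r.1, r.1, hL.mem_level_of_reps r, rfl⟩ : Reps G L (m + 1)) = r :=
    Subtype.ext (orbitRep_of_reps r)
  rw [evalExt_apply (hL.mem_level_of_reps r), hL.orbitElt_of_reps, map_one, h]
  rfl

lemma IsFreeAcyclic.evalExt_restrict (hL : IsFreeAcyclic 𝕜 G L) {f : List V → E}
    (hf : IsFreeAcyclic.Equivariant ρ.toRepresentation L m f) {l : List V} (hl : l ∈ level L m) :
    evalExt L m ρ l (fun r => f r.1) = f l := by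
  rw [evalExt_apply hl, ← hf _ _ (hL.orbitRep_mem_level hl), act_orbitElt]

/-- The coboundary of an equivariant function is equivariant. -/
lemma IsFreeAcyclic.linearCombination_bdList_act (hL : IsFreeAcyclic 𝕜 G L) {f : List V → E}
    (hf : IsFreeAcyclic.Equivariant ρ.toRepresentation L m f) (g : G) {l : List V}
    (hl : l ∈ level L (m + 1)) :
    Finsupp.linearCombination 𝕜 f (bdList 𝕜 (act g l)) =
      ρ.toRepresentation g (Finsupp.linearCombination 𝕜 f (bdList 𝕜 l)) := by
  have h : bdList 𝕜 l ∈ chains 𝕜 (level L m) := by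
    have := hL.bd_mem_level (single_mem_chains (k := 𝕜) hl 1)
    rwa [bd_single, one_smul] at this
  rw [act, bdList_map]
  exact eq_of_forall_single (Finsupp.linearCombination 𝕜 f ∘ₗ map (g • ·))
    (ρ.toRepresentation g ∘ₗ Finsupp.linearCombination 𝕜 f) (fun l hl => by
      simpa [act] using hf g l hl) h

lemma IsFreeAcyclic.coboundary_restrict (hL : IsFreeAcyclic 𝕜 G L) {f : List V → E}
    (hf : IsFreeAcyclic.Equivariant ρ.toRepresentation L m f) (r : Reps G L (m + 1)) :
    coboundary L m ρ (fun r => f r.1) r = Finsupp.linearCombination 𝕜 f (bdList 𝕜 r.1) := by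
  have hr := hL.mem_level_of_reps r
  rw [coboundary_apply]
  exact linearCombination_bdList_congr fun l hl hlen => hL.evalExt_restrict hf
    ⟨hL.sublist _ hr.1 _ hl, by have := hr.2; omega⟩

lemma IsFreeAcyclic.linearCombination_eq_zero_of_coboundary (hL : IsFreeAcyclic 𝕜 G L)
    {f : List V → E} (hf : IsFreeAcyclic.Equivariant ρ.toRepresentation L m f)
    (h : coboundary L m ρ (fun r => f r.1) = 0) {l : List V} (hl : l ∈ level L (m + 1)) :
    Finsupp.linearCombination 𝕜 f (bdList 𝕜 l) = 0 := by
  have h1 := congrFun h ⟨orbitRep G l, l, hl, rfl⟩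
  rw [hL.coboundary_restrict hf] at h1
  rw [← act_orbitElt (G := G) l, hL.linearCombination_bdList_act hf _ (hL.orbitRep_mem_level hl),
    h1]
  exact map_zero _

/-- The cohomology in positive degrees in terms of the coboundary operators. -/
theorem IsFreeAcyclic.subsingleton_cohomology_succ_iff (hL : IsFreeAcyclic 𝕜 G L) (n : ℕ) :
    Subsingleton (ρ.cohomology (n + 1)) ↔
      ∀ x, coboundary L (n + 2) ρ x = 0 → ∃ y, coboundary L (n + 1) ρ y = x := by
  rw [BoundedRep.cohomology, hL.subsingleton_groupCohomology_succ_iff]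
  change (∀ f : List V → E, Equivariant ρ.toRepresentation L (n + 2) f →
        (∀ l ∈ level L (n + 3), Finsupp.linearCombination 𝕜 f (bdList 𝕜 l) = 0) →
        ∃ h : List V → E, Equivariant ρ.toRepresentation L (n + 1) h ∧
          ∀ l ∈ level L (n + 2), Finsupp.linearCombination 𝕜 h (bdList 𝕜 l) = f l) ↔ _
  constructor
  · intro H x hx
    have hres : (fun r : Reps G L (n + 2) => evalExt L (n + 2) ρ r.1 x) = x :=
      funext fun r => hL.evalExt_of_reps x r
    obtain ⟨h, hh, hd⟩ := H _ (hL.equivariant_evalExt x) (fun l hl =>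
      hL.linearCombination_eq_zero_of_coboundary (hL.equivariant_evalExt x) (by rw [hres, hx]) hl)
    refine ⟨fun r => h r.1, funext fun r => ?_⟩
    rw [hL.coboundary_restrict hh, hd _ (hL.mem_level_of_reps r), hL.evalExt_of_reps]
  · intro H f hf hd
    obtain ⟨y, hy⟩ := H (fun r => f r.1) (funext fun r => by
      rw [hL.coboundary_restrict hf]
      exact hd _ (hL.mem_level_of_reps r))
    refine ⟨fun l => evalExt L (n + 1) ρ l y, hL.equivariant_evalExt y, fun l hl => ?_⟩
    have h1 := congrFun hy ⟨orbitRep G l, l, hl, rfl⟩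
    rw [coboundary_apply] at h1
    rw [← act_orbitElt (G := G) l, hL.linearCombination_bdList_act (hL.equivariant_evalExt y) _
      (hL.orbitRep_mem_level hl), h1, hf _ _ (hL.orbitRep_mem_level hl)]

/-- The cohomology in degree zero in terms of the coboundary operators. -/
theorem IsFreeAcyclic.subsingleton_cohomology_zero_iff (hL : IsFreeAcyclic 𝕜 G L) :
    Subsingleton (ρ.cohomology 0) ↔ ∀ x, coboundary L 1 ρ x = 0 → x = 0 := by
  rw [BoundedRep.cohomology, hL.subsingleton_groupCohomology_zero_iff]
  change (∀ f : List V → E, Equivariant ρ.toRepresentation L 1 f →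
        (∀ l ∈ level L 2, Finsupp.linearCombination 𝕜 f (bdList 𝕜 l) = 0) →
        ∀ l ∈ level L 1, f l = 0) ↔ _
  constructor
  · intro H x hx
    have hres : (fun r : Reps G L 1 => evalExt L 1 ρ r.1 x) = x :=
      funext fun r => hL.evalExt_of_reps x r
    have h := H _ (hL.equivariant_evalExt x) (fun l hl =>
      hL.linearCombination_eq_zero_of_coboundary (hL.equivariant_evalExt x) (by rw [hres, hx]) hl)
    funext r
    rw [← hL.evalExt_of_reps (ρ := ρ) x r, h _ (hL.mem_level_of_reps r)]
    rfl
  · intro H f hf hd l hl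
    have h1 := congrFun (H (fun r => f r.1) (funext fun r => by
      rw [hL.coboundary_restrict hf]
      exact hd _ (hL.mem_level_of_reps r))) ⟨orbitRep G l, l, hl, rfl⟩
    rw [← act_orbitElt (G := G) l, hf _ _ (hL.orbitRep_mem_level hl)]
    exact (congrArg _ h1).trans (map_zero _)

lemma IsFreeAcyclic.coboundary_coboundary (hL : IsFreeAcyclic 𝕜 G L)
    (x : Reps G L (m + 1) → E) :
    coboundary L (m + 2) ρ (coboundary L (m + 1) ρ x) = 0 := by
  funext r
  have hr := hL.mem_level_of_reps r
  have hx := hL.equivariant_evalExt (ρ := ρ) x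
  have h1 : Equivariant ρ.toRepresentation L (m + 2)
      (fun l => Finsupp.linearCombination 𝕜 (fun l => evalExt L (m + 1) ρ l x) (bdList 𝕜 l)) :=
    fun g l hl => hL.linearCombination_bdList_act hx g hl
  have h2 : coboundary L (m + 1) ρ x = fun r : Reps G L (m + 2) =>
      Finsupp.linearCombination 𝕜 (fun l => evalExt L (m + 1) ρ l x) (bdList 𝕜 r.1) :=
    funext fun r => coboundary_apply x r
  rw [h2, hL.coboundary_restrict h1]
  have h3 : Finsupp.linearCombination 𝕜 (fun l => Finsupp.linearCombination 𝕜
      (fun l => evalExt L (m + 1) ρ l x) (bdList 𝕜 l)) =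
      Finsupp.linearCombination 𝕜 (fun l => evalExt L (m + 1) ρ l x) ∘ₗ bd := by
    ext l
    simp [bd_single]
  rw [h3, LinearMap.comp_apply, bd_bdList, map_zero]
  rfl

/-- The coboundary is a finite sum of matrix entries, each depending on the representation through a
single group element, so pointwise convergence on the group suffices for norm convergence. -/
lemma tendsto_coboundary [Fintype (Reps G L m)] [Fintype (Reps G L (m + 1))]
    {ι : Type*} {l : Filter ι} {σ : ι → BoundedRep 𝕜 G E}
    (h : ∀ g, Tendsto (fun i => (σ i g : E →L[𝕜] E)) l (𝓝 (ρ g : E →L[𝕜] E))) :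
    Tendsto (fun i => coboundary L m (σ i)) l (𝓝 (coboundary L m ρ)) := by
  classical
  have key : ∀ τ : BoundedRep 𝕜 G E, coboundary L m τ = ∑ r : Reps G L (m + 1),
      (ContinuousLinearMap.single 𝕜 (fun _ : Reps G L (m + 1) => E) r) ∘L
        ∑ p ∈ (bdList 𝕜 r.1).support, bdList 𝕜 r.1 p • evalExt L m τ p := by
    intro τ
    ext x r
    rw [coboundary_apply]
    simp [Finset.sum_apply, Pi.single_apply,
      Finsupp.linearCombination_apply, Finsupp.sum]
  have hev : ∀ p : List V, Tendsto (fun i => evalExt L m (σ i) p) l (𝓝 (evalExt L m ρ p)) := by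
    intro p
    unfold evalExt
    split_ifs with hp
    · exact ((continuous_id.clm_comp continuous_const).tendsto _).comp (h _)
    · exact tendsto_const_nhds
  simp only [key]
  exact tendsto_finsetSum _ fun r _ => ((continuous_const.clm_comp continuous_id).tendsto _).comp
    (tendsto_finsetSum _ fun p _ => (hev p).const_smul _)

/-- The range is the kernel of the next coboundary. Only continuity of the latter for the product
topology is used, so its target may involve infinitely many orbits; this is why type F_{n+1} is
enough. -/
lemma IsFreeAcyclic.isClosed_range_coboundary (hL : IsFreeAcyclic 𝕜 G L)
    (h : Subsingleton (ρ.cohomology (m + 1))) :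
    IsClosed (Set.range (coboundary L (m + 1) ρ)) := by
  have : Set.range (coboundary L (m + 1) ρ) = coboundary L (m + 2) ρ ⁻¹' {0} := by
    ext x
    refine ⟨?_, fun hx => (hL.subsingleton_cohomology_succ_iff m).1 h x hx⟩
    rintro ⟨y, rfl⟩
    exact hL.coboundary_coboundary y
  rw [this]
  exact isClosed_singleton.preimage (coboundary L (m + 2) ρ).continuous

end Cochains

end ListChain

/-! ### The main theorem -/

open ListChain

theorem mainTheorem8 {𝕜 Γ E : Type u} [RCLike 𝕜] [Group Γ]
    [NormedAddCommGroup E] [NormedSpace 𝕜 E] [CompleteSpace E]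
    (n : ℕ) (hΓ : IsTypeF Γ (n + 1))
    (S : Finset Γ) (hS : Subgroup.closure (S : Set Γ) = ⊤)
    (π : BoundedRep 𝕜 Γ E) (hπ : Subsingleton (π.cohomology n))
    {ι : Type*} (l : Filter ι) [l.NeBot] (ρ : ι → BoundedRep 𝕜 Γ E)
    (hconv : Tendsto (fun i => BoundedRep.deformationDist S π (ρ i)) l (𝓝 0))
    (hρ : ∀ i, Nontrivial ((ρ i).cohomology n)) :
    Nontrivial (π.cohomology (n + 1)) := by
  obtain ⟨V, _, X, hX, hinv, hfree, T, hT, -, hTX⟩ := hΓ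
  by_contra hnt
  rw [not_nontrivial_iff_subsingleton] at hnt
  have hL : IsFreeAcyclic 𝕜 Γ (faceLists X) := isFreeAcyclic_faceLists 𝕜 hinv hfree
  have hfin : ∀ m ≤ n + 1, Finite (Reps Γ (faceLists X) (m + 1)) := fun m hm =>
    (finite_orbitReps hm hT hTX).to_subtype
  have hg := BoundedRep.tendsto_apply hS hconv
  have := hfin n (by omega)
  have := hfin (n + 1) le_rfl
  have := Fintype.ofFinite (Reps Γ (faceLists X) (n + 1))
  have := Fintype.ofFinite (Reps Γ (faceLists X) (n + 2))
  have hB := tendsto_coboundary (L := faceLists X) (m := n + 1) hg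
  have hcl := hL.isClosed_range_coboundary hnt
  suffices h : ∀ᶠ i in l, Subsingleton ((ρ i).cohomology n) by
    obtain ⟨i, hi⟩ := h.exists
    exact not_subsingleton _ hi
  rcases n with _ | n
  -- In degree 0 nothing precedes C^0, so the zero map from `E` serves as the incoming map and
  -- exactness means injectivity of the coboundary.
  · refine (eventually_exact_of_tendsto (A₀ := (0 : E →L[𝕜] _)) (A := fun _ => 0) (by simp)
      (fun x hx => ⟨0, ?_⟩) hcl tendsto_const_nhds hB (by simp)).mono fun i hi => ?_
    · exact (hL.subsingleton_cohomology_zero_iff.1 hπ x hx).symm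
    · refine hL.subsingleton_cohomology_zero_iff.2 fun x hx => ?_
      obtain ⟨w, hw⟩ := hi x hx
      exact hw.symm
  · have := hfin n (by omega)
    have := Fintype.ofFinite (Reps Γ (faceLists X) (n + 1))
    refine (eventually_exact_of_tendsto (hL.coboundary_coboundary (ρ := π) (m := n))
      ((hL.subsingleton_cohomology_succ_iff n).1 hπ) hcl
      (tendsto_coboundary hg) hB (fun i => hL.coboundary_coboundary)).mono fun i hi => ?_
    exact (hL.subsingleton_cohomology_succ_iff n).2 hi
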